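/- Let $F=\mathbb F_q$ be a finite field with $q$ odd and let $\psi:F\to\mathbb C^\times$ be a non-trivial additive character. Let $\mathsf{Symp}$ be the groupoid of finite-dimensional symplectic vector spaces $(V,\omega)$ over $F$ and linear symplectic isomorphisms. **Definitions.** Let $V\in\mathsf{Symp}$ with $\dim V=2n$. The Heisenberg group $H(V)=V\times F$ has the multiplication $(v,z)(v',z')=(v+v',z+z'+\tfrac12\omega(v,v'))$. An oriented Lagrangian (resp. isotropic) subspace is a pair $L^\circ=(L,o_L)$ with $L\subset V$ Lagrangian (resp. isotropic) and $0\ne o_L\in\bigwedge^{top}L$; let $OLag(V)$ be the set of oriented Lagrangians. For $L^\circ\in OLag(V)$ let $\mathcal H_{L^\circ}$ be the space of functions $f:H(V)\to\mathbb C$ with $f((0,z)h)=\psi(z)f(h)$ and $f((l,0)h)=f(h)$ for all $z\in F$, $l\in L$, $h\in H(V)$, on which $H(V)$ acts by right translation. A trivialization is a system of intertwining isomorphisms $T_{M^\circ,L^\circ}:\mathcal H_{L^\circ}\to\mathcal H_{M^\circ}$, $(M^\circ,L^\circ)\in OLag(V)^2$, with $T_{N^\circ,M^\circ}\circ T_{M^\circ,L^\circ}=T_{N^\circ,L^\circ}$.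 It is called canonical if for all $M^\circ,L^\circ$ with $M+L=V$ $$T_{M^\circ,L^\circ}[f](h)=\Big(\frac{G_1}{q}\Big)^{n}\sigma\big((-1)^{\binom n2}\omega_\wedge(o_L,o_M)\big)\sum_{m\in M}f\big((m,0)h\big),$$ where $\sigma$ is the quadratic character of $F^\times$, $G_1=\sum_{z\in F}\psi(\tfrac12z^2)$, and $\omega_\wedge$ is the bilinear pairing with $(-1)^{\binom n2}\,\omega_\wedge(l_1\wedge\dots\wedge l_n,m_1\wedge\dots\wedge m_n)=\det(\omega(l_i,m_j))_{i,j}$. Let $\{T_{M^\circ,L^\circ}\}$ be the canonical trivialization of $V$, and let $\mathcal H(V)$ be the space of families $(v_{L^\circ}\in\mathcal H_{L^\circ})_{L^\circ\in OLag(V)}$ with $T_{M^\circ,L^\circ}(v_{L^\circ})=v_{M^\circ}$ for all $(M^\circ,L^\circ)$. A symplectic isomorphism $f:V\to U$ induces $\mathcal H(f):\mathcal H(U)\to\mathcal H(V)$, $(\mathcal H(f)v)_{L^\circ}(x,z)=v_{f(L^\circ)}(f(x),z)$, and $\rho_V(g)=\mathcal H(g^{-1})$ is the canonical model of the Weil representation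 of $Sp(V)$ on $\mathcal H(V)$. The group $H(V)$ acts on $\mathcal H(V)$ fiberwise, and for an isotropic subspace $I\subset V$, $\mathcal H(V)^I$ is the subspace of vectors fixed by all $(i,0)$, $i\in I$. The reduction $I^\perp/I$ carries the induced symplectic form. **Proposition.** For every $V\in\mathsf{Symp}$ there is exactly one canonical trivialization, so that $\mathcal H(V)$ is well defined, and there are $\mathbb C$-linear isomorphisms $$\alpha_{(I^\circ,V)}:\mathcal H(V)^I\xrightarrow{\ \simeq\ }\mathcal H(I^\perp/I),$$ one for each $V\in\mathsf{Symp}$ and each oriented isotropic subspace $I^\circ=(I,o_I)$ of $V$, such that: 1. (naturality) for every symplectic isomorphism $f:V\to U$ with $f(I^\circ)=J^\circ$ and induced map $f_I:I^\perp/I\to J^\perp/J$, $\mathcal H(f)$ maps $\mathcal H(U)^J$ into $\mathcal H(V)^I$, and $\mathcal H(f_I)\circ\alpha_{(J^\circ,U)}=\alpha_{(I^\circ,V)}\circ\mathcal H(f)$ on $\mathcal H(U)^J$; 2. for every $V$ and $I^\circ$, let $P\subset Sp(V)$ be the subgroup of all $g$ with $g(I^\circ)=I^\circ$ and let $\pi:P\to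 Sp(I^\perp/I)$ be the canonical homomorphism. Then $\mathcal H(V)^I$ is stable under $\rho_V(P)$, and $\alpha_{(I^\circ,V)}$ is an isomorphism of representations of $P$ from $\rho_V|_P$ on $\mathcal H(V)^I$ to $\rho_{I^\perp/I}\circ\pi$; in particular, the action of $P$ on $\mathcal H(V)^I$ factors through $Sp(I^\perp/I)$. -/

import Mathlib

universe u v

noncomputable section

namespace Quantization

/-- A finite dimensional symplectic vector space over `F`. -/
structure SympSpace (F : Type u) [Field F] where
  carrier : Type v
  [addCommGroup : AddCommGroup carrier]
  [module : Module F carrier]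
  [finite : Module.Finite F carrier]
  form : LinearMap.BilinForm F carrier
  isAlt : form.IsAlt
  nondegenerate : form.Nondegenerate

attribute [instance] SympSpace.addCommGroup SympSpace.module SympSpace.finite

instance instCoeSortSympSpace {F : Type u} [Field F] : CoeSort (SympSpace.{u, v} F) (Type v) :=
  ⟨SympSpace.carrier⟩

section General

variable {F : Type u} [Field F]

/-- The orthogonal complement with respect to the symplectic form. -/
def SympSpace.perp (V : SympSpace.{u, v} F) (N : Submodule F V) : Submodule F V :=
  V.form.orthogonal N

/-- Half of the dimension, so that `V` is `2n`-dimensional for `n = V.halfDim`. -/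
def SympSpace.halfDim (V : SympSpace.{u, v} F) : ℕ := Module.finrank F V / 2

theorem SympSpace.mem_perp {V : SympSpace.{u, v} F} {N : Submodule F V} {x : V} :
    x ∈ V.perp N ↔ ∀ y ∈ N, V.form y x = 0 := Iff.rfl

theorem SympSpace.perp_perp (V : SympSpace.{u, v} F) (N : Submodule F V) :
    V.perp (V.perp N) = N :=
  LinearMap.BilinForm.orthogonal_orthogonal V.nondegenerate V.isAlt.isRefl N

theorem SympSpace.form_swap (V : SympSpace.{u, v} F) (x y : V) :
    V.form x y = - V.form y x := (V.isAlt.neg_eq y x).symm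

theorem SympSpace.perp_anti {V : SympSpace.{u, v} F} {N M : Submodule F V} (h : N ≤ M) :
    V.perp M ≤ V.perp N := fun _ hx y hy => hx y (h hy)

/-- Morphisms of symplectic vector spaces: linear isomorphisms preserving the form. -/
structure SympIso (V U : SympSpace.{u, v} F) extends V ≃ₗ[F] U where
  map_form : ∀ x y : V, U.form (toFun x) (toFun y) = V.form x y

namespace SympIso

variable {V U W : SympSpace.{u, v} F}

@[ext] theorem ext {f g : SympIso V U} (h : ∀ x, f.toLinearEquiv x = g.toLinearEquiv x) :
    f = g := by
  cases f; cases g; congr; exact LinearEquiv.ext h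

theorem form_apply (f : SympIso V U) (x y : V) :
    U.form (f.toLinearEquiv x) (f.toLinearEquiv y) = V.form x y := f.map_form x y

/-- The identity morphism. -/
def refl (V : SympSpace.{u, v} F) : SympIso V V := ⟨LinearEquiv.refl F V, fun _ _ => rfl⟩

/-- Composition: `f.trans g = g ∘ f`. -/
def trans (f : SympIso V U) (g : SympIso U W) : SympIso V W :=
  ⟨f.toLinearEquiv.trans g.toLinearEquiv,
    fun x y => (g.form_apply _ _).trans (f.form_apply x y)⟩

/-- The inverse morphism. -/
def symm (f : SympIso V U) : SympIso U V :=
  ⟨f.toLinearEquiv.symm, fun x y => by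
    have := f.form_apply (f.toLinearEquiv.symm x) (f.toLinearEquiv.symm y)
    simpa using this.symm⟩

/-- The symplectic group `Sp(V)`, with composition as multiplication. -/
instance : Group (SympIso V V) where
  mul g f := f.trans g
  one := refl V
  inv := symm
  mul_assoc _ _ _ := rfl
  one_mul _ := rfl
  mul_one _ := rfl
  inv_mul_cancel f := by
    apply SympIso.ext
    intro x
    exact f.toLinearEquiv.symm_apply_apply x

theorem mul_def (g f : SympIso V V) : g * f = f.trans g := rfl
theorem one_def : (1 : SympIso V V) = refl V := rfl
theorem inv_def (f : SympIso V V) : f⁻¹ = f.symm := rfl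

theorem map_perp (f : SympIso V U) (N : Submodule F V) :
    (V.perp N).map (f.toLinearEquiv : V →ₗ[F] U) =
      U.perp (N.map (f.toLinearEquiv : V →ₗ[F] U)) := by
  ext x
  constructor
  · rintro ⟨y, hy, rfl⟩
    rintro _ ⟨z, hz, rfl⟩
    exact (f.form_apply z y).trans (hy z hz)
  · intro hx
    refine ⟨f.toLinearEquiv.symm x, ?_, by simp⟩
    intro z hz
    have := hx _ ⟨z, hz, rfl⟩
    have h2 := f.form_apply z (f.toLinearEquiv.symm x)
    simp only [LinearEquiv.apply_symm_apply] at h2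
    exact h2.symm.trans this

end SympIso

/-! ### Oriented subspaces -/

/-- The top exterior power of a subspace `L`, viewed inside the exterior algebra of the ambient
space (over a field the map induced by the inclusion of `L` is injective). -/
def topPower {E : Type v} [AddCommGroup E] [Module F E] (L : Submodule F E) :
    Submodule F (ExteriorAlgebra F E) :=
  (⋀[F]^(Module.finrank F L) L).map (ExteriorAlgebra.map L.subtype).toLinearMap

/-- A pair `(L, o_L)` of a subspace and a non-zero vector `o_L ∈ ⋀^top L`. -/
@[ext] structure OSubspace (V : SympSpace.{u, v} F) where
  space : Submodule F V
  vec : ExteriorAlgebra F V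
  vec_mem : vec ∈ topPower space
  vec_ne : vec ≠ 0

/-- An oriented isotropic subspace. -/
@[ext] structure OIso (V : SympSpace.{u, v} F) extends OSubspace V where
  isotropic : space ≤ V.perp space

/-- An oriented Lagrangian subspace. -/
@[ext] structure OLag (V : SympSpace.{u, v} F) extends OSubspace V where
  lagrangian : V.perp space = space

section ExteriorHelpers

variable {E E' : Type v} [AddCommGroup E] [Module F E] [AddCommGroup E'] [Module F E']

theorem coe_exteriorPower_map (f : E →ₗ[F] E') (n : ℕ) (x : ⋀[F]^n E) :
    (exteriorPower.map n f x : ExteriorAlgebra F E') = ExteriorAlgebra.map f x := by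
  have h : (⋀[F]^n E').subtype ∘ₗ exteriorPower.map n f =
      (ExteriorAlgebra.map f).toLinearMap ∘ₗ (⋀[F]^n E).subtype := by
    apply exteriorPower.linearMap_ext
    ext m
    simp [exteriorPower.map_apply_ιMulti, ExteriorAlgebra.map_apply_ιMulti]
  exact LinearMap.congr_fun h x

theorem map_exteriorPower_le (f : E →ₗ[F] E') (n : ℕ) {x : ExteriorAlgebra F E}
    (hx : x ∈ ⋀[F]^n E) : ExteriorAlgebra.map f x ∈ ⋀[F]^n E' := by
  have h := coe_exteriorPower_map f n ⟨x, hx⟩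
  rw [← h]
  exact (exteriorPower.map n f ⟨x, hx⟩).2

theorem map_topPower (f : E ≃ₗ[F] E') (L : Submodule F E) {x : ExteriorAlgebra F E}
    (hx : x ∈ topPower L) :
    ExteriorAlgebra.map (f : E →ₗ[F] E') x ∈ topPower (L.map (f : E →ₗ[F] E')) := by
  obtain ⟨y, hy, rfl⟩ := hx
  let g := f.submoduleMap L
  refine ⟨ExteriorAlgebra.map (g : L →ₗ[F] L.map (f : E →ₗ[F] E')) y, ?_, ?_⟩
  · rw [← g.finrank_eq]
    exact map_exteriorPower_le _ _ hy
  · have h1 := ExteriorAlgebra.map_comp_map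
      (g : L →ₗ[F] L.map (f : E →ₗ[F] E')) (L.map (f : E →ₗ[F] E')).subtype
    have h2 := ExteriorAlgebra.map_comp_map L.subtype (f : E →ₗ[F] E')
    have h3 : (L.map (f : E →ₗ[F] E')).subtype ∘ₗ (g : L →ₗ[F] L.map (f : E →ₗ[F] E')) =
        (f : E →ₗ[F] E') ∘ₗ L.subtype := rfl
    rw [h3, ← h2] at h1
    exact DFunLike.congr_fun h1 y

theorem map_map_ext {E'' : Type v} [AddCommGroup E''] [Module F E''] (f : E →ₗ[F] E')
    (g : E' →ₗ[F] E'') (x : ExteriorAlgebra F E) :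
    ExteriorAlgebra.map g (ExteriorAlgebra.map f x) = ExteriorAlgebra.map (g ∘ₗ f) x :=
  DFunLike.congr_fun (ExteriorAlgebra.map_comp_map f g) x

theorem map_equiv_ne_zero (f : E ≃ₗ[F] E') {x : ExteriorAlgebra F E} (hx : x ≠ 0) :
    ExteriorAlgebra.map (f : E →ₗ[F] E') x ≠ 0 := by
  intro h
  apply hx
  have h2 := map_map_ext (f : E →ₗ[F] E') (f.symm : E' →ₗ[F] E) x
  rw [h, map_zero] at h2
  have h3 : (f.symm : E' →ₗ[F] E) ∘ₗ (f : E →ₗ[F] E') = LinearMap.id := by ext; simp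
  rw [h3, ExteriorAlgebra.map_id] at h2
  exact h2.symm

theorem topPower_exists (L : Submodule F E) [Module.Finite F E] :
    ∃ x ∈ topPower L, x ≠ 0 := by
  have hd : 0 < Module.finrank F (⋀[F]^(Module.finrank F L) L) := by
    rw [exteriorPower.finrank_eq]; simp
  have := Module.finrank_pos_iff.mp hd
  obtain ⟨y, hy⟩ := exists_ne (0 : ⋀[F]^(Module.finrank F L) L)
  have hinj := exteriorPower.map_injective_field (n := Module.finrank F L)
    (f := L.subtype) (by simp)
  refine ⟨ExteriorAlgebra.map L.subtype y, ⟨y, y.2, rfl⟩, ?_⟩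
  intro h
  apply hy
  apply hinj
  rw [map_zero]
  apply Subtype.ext
  rw [ZeroMemClass.coe_zero, ← h]
  exact coe_exteriorPower_map _ _ _

end ExteriorHelpers

/-- The image `f(L°) = (f(L), f_∧(o_L))`. -/
def OSubspace.map {V U : SympSpace.{u, v} F} (f : SympIso V U) (L : OSubspace V) :
    OSubspace U where
  space := L.space.map (f.toLinearEquiv : V →ₗ[F] U)
  vec := ExteriorAlgebra.map (f.toLinearEquiv : V →ₗ[F] U) L.vec
  vec_mem := map_topPower f.toLinearEquiv L.space L.vec_mem
  vec_ne := map_equiv_ne_zero f.toLinearEquiv L.vec_ne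

/-- The image of an oriented isotropic subspace under a symplectic isomorphism. -/
def OIso.map {V U : SympSpace.{u, v} F} (f : SympIso V U) (I : OIso V) : OIso U where
  toOSubspace := I.toOSubspace.map f
  isotropic := by
    change I.space.map _ ≤ U.perp (I.space.map _)
    rw [← f.map_perp]
    exact Submodule.map_mono I.isotropic

/-- The image of an oriented Lagrangian subspace under a symplectic isomorphism. -/
def OLag.map {V U : SympSpace.{u, v} F} (f : SympIso V U) (L : OLag V) : OLag U where
  toOSubspace := L.toOSubspace.map f
  lagrangian := by
    change U.perp (L.space.map _) = L.space.map _
    rw [← f.map_perp, L.lagrangian]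

theorem OSubspace.map_trans {V U W : SympSpace.{u, v} F} (f : SympIso V U) (g : SympIso U W)
    (L : OSubspace V) : L.map (f.trans g) = (L.map f).map g := by
  apply OSubspace.ext
  · exact Submodule.map_comp _ _ _
  · exact (map_map_ext _ _ _).symm

theorem OSubspace.map_refl {V : SympSpace.{u, v} F} (L : OSubspace V) :
    L.map (SympIso.refl V) = L := by
  apply OSubspace.ext
  · exact Submodule.map_id _
  · change ExteriorAlgebra.map LinearMap.id L.vec = L.vec
    rw [ExteriorAlgebra.map_id]; rfl

theorem OIso.map_trans {V U W : SympSpace.{u, v} F} (f : SympIso V U) (g : SympIso U W)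
    (L : OIso V) : L.map (f.trans g) = (L.map f).map g := by
  have := OSubspace.map_trans f g L.toOSubspace
  exact OIso.ext (congrArg OSubspace.space this) (congrArg OSubspace.vec this)

theorem OIso.map_refl {V : SympSpace.{u, v} F} (L : OIso V) :
    L.map (SympIso.refl V) = L := by
  have := OSubspace.map_refl L.toOSubspace
  exact OIso.ext (congrArg OSubspace.space this) (congrArg OSubspace.vec this)

theorem OLag.map_trans {V U W : SympSpace.{u, v} F} (f : SympIso V U) (g : SympIso U W)
    (L : OLag V) : L.map (f.trans g) = (L.map f).map g := by
  have := OSubspace.map_trans f g L.toOSubspace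
  exact OLag.ext (congrArg OSubspace.space this) (congrArg OSubspace.vec this)

theorem OLag.map_refl {V : SympSpace.{u, v} F} (L : OLag V) :
    L.map (SympIso.refl V) = L := by
  have := OSubspace.map_refl L.toOSubspace
  exact OLag.ext (congrArg OSubspace.space this) (congrArg OSubspace.vec this)

theorem OLag.finrank_eq {V : SympSpace.{u, v} F} (L : OLag V) :
    Module.finrank F L.space = V.halfDim := by
  have h : Module.finrank F L.space = Module.finrank F V - Module.finrank F L.space := by
    conv_lhs => rw [← L.lagrangian]
    exact LinearMap.BilinForm.finrank_orthogonal V.nondegenerate L.space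
  have h2 := Submodule.finrank_le L.space
  unfold SympSpace.halfDim
  omega

/-- The orientation of an oriented Lagrangian, as an element of `⋀^n V`, where `dim V = 2n`. -/
def OLag.vecPower {V : SympSpace.{u, v} F} (L : OLag V) : ⋀[F]^(V.halfDim) V :=
  ⟨L.vec, by
    obtain ⟨y, hy, h⟩ := L.vec_mem
    rw [← h, ← L.finrank_eq]
    exact map_exteriorPower_le _ _ hy⟩

/-- The pairing of `n`-vectors induced by the symplectic form, by successive contraction of
neighbouring vectors: `(l₁ ∧ ⋯ ∧ lₙ, m₁ ∧ ⋯ ∧ mₙ) ↦ ω(lₙ, m₁) ω(lₙ₋₁, m₂) ⋯ ω(l₁, mₙ)`,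
antisymmetrized, that is `(-1) ^ (n choose 2) * det (ω(lᵢ, mⱼ))`. -/
def omegaWedge (V : SympSpace.{u, v} F) (n : ℕ) (a b : ⋀[F]^n V) : F :=
  (-1) ^ (n.choose 2) * exteriorPower.pairingDual F V n (exteriorPower.map n V.form a) b

theorem omegaWedge_ιMulti (V : SympSpace.{u, v} F) (n : ℕ) (l m : Fin n → V) :
    omegaWedge V n (exteriorPower.ιMulti F n l) (exteriorPower.ιMulti F n m) =
      (-1) ^ (n.choose 2) * (Matrix.of fun i j => V.form (l i) (m j)).det := by
  unfold omegaWedge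
  rw [exteriorPower.map_apply_ιMulti, exteriorPower.pairingDual_ιMulti_ιMulti,
    ← Matrix.det_transpose]
  rfl

theorem omegaWedge_map {V U : SympSpace.{u, v} F} (f : SympIso V U) (n : ℕ)
    (a b : ⋀[F]^n V) :
    omegaWedge U n (exteriorPower.map n (f.toLinearEquiv : V →ₗ[F] U) a)
      (exteriorPower.map n (f.toLinearEquiv : V →ₗ[F] U) b) = omegaWedge V n a b := by
  let P (W : SympSpace.{u, v} F) : ⋀[F]^n W →ₗ[F] ⋀[F]^n W →ₗ[F] F :=
    exteriorPower.pairingDual F W n ∘ₗ exteriorPower.map n W.form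
  have key : (P U).compl₁₂ (exteriorPower.map n (f.toLinearEquiv : V →ₗ[F] U))
      (exteriorPower.map n (f.toLinearEquiv : V →ₗ[F] U)) = P V := by
    apply exteriorPower.linearMap_ext
    ext l : 1
    apply exteriorPower.linearMap_ext
    ext m
    simp [P, exteriorPower.map_apply_ιMulti, exteriorPower.pairingDual_ιMulti_ιMulti,
      f.form_apply]
  unfold omegaWedge
  congr 1
  exact LinearMap.congr_fun₂ key a b

theorem SympIso.halfDim_eq {V U : SympSpace.{u, v} F} (f : SympIso V U) :
    V.halfDim = U.halfDim := by
  unfold SympSpace.halfDim; rw [f.toLinearEquiv.finrank_eq]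

theorem omegaWedge_vecPower_map {V U : SympSpace.{u, v} F} (f : SympIso V U) (L M : OLag V) :
    omegaWedge U U.halfDim (L.map f).vecPower (M.map f).vecPower =
      omegaWedge V V.halfDim L.vecPower M.vecPower := by
  have aux : ∀ (n m : ℕ) (_ : n = m) (a b : ⋀[F]^n V) (a' b' : ⋀[F]^m U),
      (a' : ExteriorAlgebra F U) = ExteriorAlgebra.map (f.toLinearEquiv : V →ₗ[F] U) a →
      (b' : ExteriorAlgebra F U) = ExteriorAlgebra.map (f.toLinearEquiv : V →ₗ[F] U) b →
      omegaWedge U m a' b' = omegaWedge V n a b := by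
    rintro n _ rfl a b a' b' ha hb
    have ha' : a' = exteriorPower.map n (f.toLinearEquiv : V →ₗ[F] U) a := 
      Subtype.ext (ha.trans (coe_exteriorPower_map _ _ _).symm)
    have hb' : b' = exteriorPower.map n (f.toLinearEquiv : V →ₗ[F] U) b := 
      Subtype.ext (hb.trans (coe_exteriorPower_map _ _ _).symm)
    rw [ha', hb', omegaWedge_map]
  exact aux _ _ f.halfDim_eq _ _ _ _ rfl rfl

/-! ### Existence of a Lagrangian in general position to two given ones -/

theorem exists_notMem_of_ne_top {E : Type v} [AddCommGroup E] [Module F E]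
    {A B C : Submodule F E} (hA : ¬ C ≤ A) (hB : ¬ C ≤ B) : ∃ x ∈ C, x ∉ A ∧ x ∉ B := by
  obtain ⟨a, haC, haA⟩ := SetLike.not_le_iff_exists.mp hA
  obtain ⟨b, hbC, hbB⟩ := SetLike.not_le_iff_exists.mp hB
  by_cases h1 : a ∈ B
  · by_cases h2 : b ∈ A
    · refine ⟨a + b, C.add_mem haC hbC, fun h => haA ?_, fun h => hbB ?_⟩
      · simpa using A.sub_mem h h2
      · simpa using B.sub_mem h h1
    · exact ⟨b, hbC, h2, hbB⟩
  · exact ⟨a, haC, haA, h1⟩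

theorem perp_not_le {V : SympSpace.{u, v} F} {S N : Submodule F V}
    (hS : S ≤ V.perp S) (hne : ¬ V.perp S ≤ S) (hN : V.perp N = N) :
    ¬ V.perp S ≤ S ⊔ N := by
  intro hle
  have h1 : V.perp S ⊓ N ≤ S := by
    intro x hx
    suffices x ∈ V.perp (V.perp S) by rwa [V.perp_perp] at this
    intro y hy
    obtain ⟨s, hs, n, hn, rfl⟩ := Submodule.mem_sup.mp (hle hy)
    have e1 : V.form s x = 0 := hx.1 s hs
    have e2 : V.form n x = 0 := by
      have : x ∈ V.perp N := by rw [hN]; exact hx.2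
      exact this n hn
    change V.form (s + n) x = 0
    rw [map_add, LinearMap.add_apply, e1, e2, add_zero]
  apply hne
  intro y hy
  obtain ⟨s, hs, n, hn, rfl⟩ := Submodule.mem_sup.mp (hle hy)
  have hn' : n ∈ V.perp S := by
    have := (V.perp S).sub_mem hy (hS hs)
    simpa using this
  exact S.add_mem hs (h1 ⟨hn', hn⟩)

theorem exists_common_transversal {V : SympSpace.{u, v} F} (N L : Submodule F V)
    (hN : V.perp N = N) (hL : V.perp L = L) :
    ∃ S : Submodule F V, V.perp S = S ∧ S ⊓ N = ⊥ ∧ S ⊓ L = ⊥ := by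
  obtain ⟨S, ⟨hS, hSN, hSL⟩, hmax⟩ := WellFounded.has_min
    (wellFounded_gt (α := Submodule F V))
    {S | S ≤ V.perp S ∧ S ⊓ N = ⊥ ∧ S ⊓ L = ⊥} ⟨⊥, by simp⟩
  refine ⟨S, ?_, hSN, hSL⟩
  by_contra hne
  have hnle : ¬ V.perp S ≤ S := fun h => hne (le_antisymm h hS)
  obtain ⟨x, hx, hxN, hxL⟩ := exists_notMem_of_ne_top
    (perp_not_le hS hnle hN) (perp_not_le hS hnle hL)
  have aux : ∀ Q : Submodule F V, S ⊓ Q = ⊥ → x ∉ S ⊔ Q →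
      (S ⊔ Submodule.span F {x}) ⊓ Q = ⊥ := by
    intro Q hQ hxQ
    rw [eq_bot_iff]
    rintro y ⟨hy, hyQ⟩
    obtain ⟨s, hs, t, ht, rfl⟩ := Submodule.mem_sup.mp hy
    obtain ⟨c, rfl⟩ := Submodule.mem_span_singleton.mp ht
    by_cases hc : c = 0
    · subst hc
      rw [← hQ]
      rw [zero_smul, add_zero] at hyQ ⊢
      exact ⟨hs, hyQ⟩
    · exfalso
      apply hxQ
      have : x = c⁻¹ • ((s + c • x) - s) := by
        rw [add_sub_cancel_left, smul_smul, inv_mul_cancel₀ hc, one_smul]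
      rw [this]
      exact Submodule.smul_mem _ _ (Submodule.sub_mem _ (Submodule.mem_sup_right hyQ)
        (Submodule.mem_sup_left hs))
  refine hmax (S ⊔ Submodule.span F {x}) ⟨?_, aux N hSN hxN, aux L hSL hxL⟩ ?_
  · rintro y hy z hz
    obtain ⟨s, hs, t, ht, rfl⟩ := Submodule.mem_sup.mp hy
    obtain ⟨c, rfl⟩ := Submodule.mem_span_singleton.mp ht
    obtain ⟨s', hs', t', ht', rfl⟩ := Submodule.mem_sup.mp hz
    obtain ⟨c', rfl⟩ := Submodule.mem_span_singleton.mp ht'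
    change V.form (s' + c' • x) (s + c • x) = 0
    have e1 : V.form s' s = 0 := hS hs s' hs'
    have e2 : V.form s' x = 0 := hx s' hs'
    have e3 : V.form x s = 0 := by rw [V.form_swap, hx s hs, neg_zero]
    have e4 : V.form x x = 0 := V.isAlt.self_eq_zero x
    simp [e1, e2, e3, e4]
  · apply lt_of_le_of_ne le_sup_left
    intro h
    apply hxN
    apply Submodule.mem_sup_left
    rw [h]
    exact Submodule.mem_sup_right (Submodule.mem_span_singleton_self x)

/-- Two oriented Lagrangians are in general position. -/
def GeneralPosition {V : SympSpace.{u, v} F} (M L : OLag V) : Prop :=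
  M.space ⊔ L.space = ⊤

theorem sup_eq_top_of_inf {V : SympSpace.{u, v} F} {M L : Submodule F V}
    (hM : V.perp M = M) (hL : V.perp L = L) (h : M ⊓ L = ⊥) : M ⊔ L = ⊤ := by
  have h1 : V.perp (M ⊔ L) = ⊥ := by
    rw [eq_bot_iff, ← h]
    intro x hx
    exact ⟨by rw [← hM]; exact V.perp_anti le_sup_left hx,
      by rw [← hL]; exact V.perp_anti le_sup_right hx⟩
  rw [← V.perp_perp (M ⊔ L), h1, eq_top_iff]
  intro x _ y hy
  rw [(Submodule.mem_bot F).mp hy]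
  simp

theorem OLag.exists_generalPosition {V : SympSpace.{u, v} F} (N L : OLag V) :
    ∃ S : OLag V, GeneralPosition N S ∧ GeneralPosition S L := by
  obtain ⟨S, hS, hSN, hSL⟩ :=
    exists_common_transversal N.space L.space N.lagrangian L.lagrangian
  obtain ⟨x, hx, hx0⟩ := topPower_exists S
  refine ⟨⟨⟨S, x, hx, hx0⟩, hS⟩, ?_, ?_⟩
  · exact sup_eq_top_of_inf N.lagrangian hS (by rw [inf_comm]; exact hSN)
  · exact sup_eq_top_of_inf hS L.lagrangian hSL

/-! ### The Heisenberg group -/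

/-- The Heisenberg group `V × F`. -/
@[ext] structure Heis (V : SympSpace.{u, v} F) where
  vec : V
  cen : F

namespace Heis

variable {V U W : SympSpace.{u, v} F}

instance : Group (Heis V) where
  mul g h := ⟨g.vec + h.vec, g.cen + h.cen + 2⁻¹ * V.form g.vec h.vec⟩
  one := ⟨0, 0⟩
  inv g := ⟨-g.vec, -g.cen⟩
  mul_assoc a b c := by
    apply Heis.ext
    · exact add_assoc _ _ _
    · change a.cen + b.cen + 2⁻¹ * V.form a.vec b.vec + c.cen
          + 2⁻¹ * V.form (a.vec + b.vec) c.vec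
        = a.cen + (b.cen + c.cen + 2⁻¹ * V.form b.vec c.vec)
          + 2⁻¹ * V.form a.vec (b.vec + c.vec)
      simp only [map_add, LinearMap.add_apply]
      ring
  one_mul a := by
    apply Heis.ext
    · exact zero_add _
    · change 0 + a.cen + 2⁻¹ * V.form 0 a.vec = a.cen
      simp
  mul_one a := by
    apply Heis.ext
    · exact add_zero _
    · change a.cen + 0 + 2⁻¹ * V.form a.vec 0 = a.cen
      simp
  inv_mul_cancel a := by
    apply Heis.ext
    · exact neg_add_cancel _
    · change -a.cen + a.cen + 2⁻¹ * V.form (-a.vec) a.vec = 0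
      simp [V.isAlt.self_eq_zero]

theorem mul_def (g h : Heis V) :
    g * h = ⟨g.vec + h.vec, g.cen + h.cen + 2⁻¹ * V.form g.vec h.vec⟩ := rfl

/-- The element `(0, z)` of the center. -/
def ofCen (V : SympSpace.{u, v} F) (z : F) : Heis V := ⟨0, z⟩

/-- The element `(v, 0)`; on an isotropic subspace this is a group homomorphism. -/
def ofVec (x : V) : Heis V := ⟨x, 0⟩

/-- The map of Heisenberg groups `(v, z) ↦ (f v, z)`. -/
def map (f : SympIso V U) (h : Heis V) : Heis U := ⟨f.toLinearEquiv h.vec, h.cen⟩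

theorem map_mul (f : SympIso V U) (g h : Heis V) : map f (g * h) = map f g * map f h := by
  apply Heis.ext
  · exact _root_.map_add f.toLinearEquiv _ _
  · change g.cen + h.cen + 2⁻¹ * V.form g.vec h.vec
      = g.cen + h.cen + 2⁻¹ * U.form (f.toLinearEquiv g.vec) (f.toLinearEquiv h.vec)
    rw [f.form_apply]

theorem map_symm_map (f : SympIso V U) (h : Heis V) : map f.symm (map f h) = h :=
  Heis.ext (f.toLinearEquiv.symm_apply_apply _) rfl

theorem map_map_symm (f : SympIso V U) (h : Heis U) : map f (map f.symm h) = h :=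
  Heis.ext (f.toLinearEquiv.apply_symm_apply _) rfl

theorem map_ofCen (f : SympIso V U) (z : F) : map f (ofCen V z) = ofCen U z :=
  Heis.ext (_root_.map_zero f.toLinearEquiv) rfl

theorem map_ofVec (f : SympIso V U) (x : V) :
    map f (ofVec x) = ofVec (f.toLinearEquiv x) := rfl

end Heis

/-! ### Models of the Heisenberg representation -/

/-- The space of functions on the Heisenberg group with `f (z * h) = ψ z * f h` for `z` in the
center and `f (l * h) = f h` for `l ∈ L`. -/
def model (ψ : AddChar F ℂ) {V : SympSpace.{u, v} F} (L : Submodule F V) :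
    Submodule ℂ (Heis V → ℂ) where
  carrier := {f | (∀ z h, f (Heis.ofCen V z * h) = ψ z * f h) ∧
    ∀ l ∈ L, ∀ h, f (Heis.ofVec l * h) = f h}
  zero_mem' := by constructor <;> simp
  add_mem' := by
    rintro f g ⟨h1, h2⟩ ⟨h3, h4⟩
    refine ⟨fun z h => ?_, fun l hl h => ?_⟩
    · simp only [Pi.add_apply, h1, h3]; ring
    · simp only [Pi.add_apply, h2 l hl, h4 l hl]
  smul_mem' := by
    rintro c f ⟨h1, h2⟩
    refine ⟨fun z h => ?_, fun l hl h => ?_⟩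
    · simp only [Pi.smul_apply, smul_eq_mul, h1]; ring
    · simp only [Pi.smul_apply, h2 l hl]

variable (ψ : AddChar F ℂ) {V U W : SympSpace.{u, v} F}

/-- The Heisenberg action on a model, by right translation. -/
def modelRep (L : Submodule F V) : Representation ℂ (Heis V) (model ψ L) where
  toFun g :=
    { toFun := fun f => ⟨fun h => f.1 (h * g),
        fun z h => (congrArg f.1 (mul_assoc _ _ _)).trans (f.2.1 z _),
        fun l hl h => (congrArg f.1 (mul_assoc _ _ _)).trans (f.2.2 l hl _)⟩
      map_add' := fun _ _ => rfl
      map_smul' := fun _ _ => rfl }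
  map_one' := by
    apply LinearMap.ext; intro f; apply Subtype.ext; funext h
    exact congrArg f.1 (mul_one h)
  map_mul' g g' := by
    apply LinearMap.ext; intro f; apply Subtype.ext; funext h
    exact congrArg f.1 (mul_assoc h g g').symm

/-- Pull-back of functions along the map of Heisenberg groups induced by `f`. -/
def pull (f : SympIso V U) (L : OLag V) :
    model ψ (L.map f).space ≃ₗ[ℂ] model ψ L.space where
  toFun φ := ⟨fun h => φ.1 (Heis.map f h),
    fun z h => by
      beta_reduce
      rw [Heis.map_mul, Heis.map_ofCen]
      exact φ.2.1 z _,
    fun l hl h => by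
      beta_reduce
      rw [Heis.map_mul, Heis.map_ofVec]
      exact φ.2.2 _ (Submodule.mem_map_of_mem hl) _⟩
  invFun φ := ⟨fun h => φ.1 (Heis.map f.symm h),
    fun z h => by
      beta_reduce
      rw [Heis.map_mul, Heis.map_ofCen]
      exact φ.2.1 z _,
    fun l hl h => by
      obtain ⟨x, hx, rfl⟩ := hl
      have : Heis.map f.symm (Heis.ofVec (f.toLinearEquiv x)) = Heis.ofVec x :=
        Heis.map_symm_map f (Heis.ofVec x)
      beta_reduce
      rw [Heis.map_mul]
      change φ.1 (Heis.map f.symm (Heis.ofVec (f.toLinearEquiv x)) * _) = _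
      rw [this]
      exact φ.2.2 _ hx _⟩
  map_add' _ _ := rfl
  map_smul' _ _ := rfl
  left_inv φ := by
    apply Subtype.ext; funext h; exact congrArg φ.1 (Heis.map_map_symm f h)
  right_inv φ := by
    apply Subtype.ext; funext h; exact congrArg φ.1 (Heis.map_symm_map f h)

theorem pull_modelRep (f : SympIso V U) (L : OLag V) (g : Heis V)
    (φ : model ψ (L.map f).space) :
    pull ψ f L (modelRep ψ (L.map f).space (Heis.map f g) φ) =
      modelRep ψ L.space g (pull ψ f L φ) := by
  apply Subtype.ext; funext h
  exact congrArg φ.1 (Heis.map_mul f h g).symm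

theorem ofVec_mul_ofVec_mul {M : Submodule F V} (hM : M ≤ V.perp M) {x y : V} (hx : x ∈ M)
    (hy : y ∈ M) (h : Heis V) :
    Heis.ofVec x * (Heis.ofVec y * h) = Heis.ofVec (x + y) * h := by
  rw [← mul_assoc]
  congr 1
  apply Heis.ext
  · rfl
  · have : V.form x y = 0 := hM hy x hx
    simp [Heis.mul_def, Heis.ofVec, this]

theorem ofVec_mul_ofCen_mul (x : V) (z : F) (h : Heis V) :
    Heis.ofVec x * (Heis.ofCen V z * h) = Heis.ofCen V z * (Heis.ofVec x * h) := by
  rw [← mul_assoc, ← mul_assoc]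
  congr 1
  apply Heis.ext <;> simp [Heis.mul_def, Heis.ofVec, Heis.ofCen]

theorem section_congr (s : ∀ L : OLag V, model ψ L.space) {L L' : OLag V} (h : L = L')
    (x : Heis V) : (s L).1 x = (s L').1 x := by
  subst h; rfl

end General

section FiniteField

variable {F : Type u} [Field F] [Fintype F] [DecidableEq F]
variable (ψ : AddChar F ℂ) {V U W : SympSpace.{u, v} F}

instance (V : SympSpace.{u, v} F) : Finite V := Module.finite_of_finite F

/-- Sums over the finite set of points of a subspace. -/
instance (N : Submodule F V) : Fintype N := Fintype.ofFinite N

/-- The averaging morphism `F_{M,L}[f](h) = ∑_{m ∈ M} f(m * h)`. -/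
def averaging (M L : OLag V) : model ψ L.space →ₗ[ℂ] model ψ M.space where
  toFun f := ⟨fun h => ∑ m : M.space, f.1 (Heis.ofVec (m : V) * h), by
    refine ⟨fun z h => ?_, fun l hl h => ?_⟩
    · rw [Finset.mul_sum]
      refine Finset.sum_congr rfl fun m _ => ?_
      rw [ofVec_mul_ofCen_mul]
      exact f.2.1 z _
    · refine Fintype.sum_equiv (Equiv.addRight (⟨l, hl⟩ : M.space)) _ _ fun m => ?_
      rw [ofVec_mul_ofVec_mul (le_of_eq M.lagrangian.symm) m.2 hl]
      rfl⟩
  map_add' f g := by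
    apply Subtype.ext; funext h; exact Finset.sum_add_distrib
  map_smul' c f := by
    apply Subtype.ext; funext h; exact (Finset.mul_sum _ _ _).symm

/-- The one dimensional Gauss sum `G₁`. -/
def gaussSumOne : ℂ := ∑ z : F, ψ (2⁻¹ * z ^ 2)

/-- The normalization constant `A_{M,L}`. -/
def normConst (M L : OLag V) : ℂ :=
  (gaussSumOne ψ / (Fintype.card F : ℂ)) ^ V.halfDim *
    (quadraticChar F ((-1) ^ (V.halfDim.choose 2) *
      omegaWedge V V.halfDim L.vecPower M.vecPower) : ℂ)

/-- A system of maps `T_{M,L} : ℋ_L → ℋ_M` between the models. -/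
abbrev System (V : SympSpace.{u, v} F) : Type _ :=
  ∀ M L : OLag V, model ψ L.space →ₗ[ℂ] model ψ M.space

/-- A trivialization: a multiplicative system of intertwining isomorphisms. -/
structure IsTrivialization (T : System ψ V) : Prop where
  intertwining : ∀ (M L : OLag V) (g : Heis V) (f : model ψ L.space),
    T M L (modelRep ψ L.space g f) = modelRep ψ M.space g (T M L f)
  bijective : ∀ M L : OLag V, Function.Bijective (T M L)
  mul : ∀ N M L : OLag V, T N M ∘ₗ T M L = T N L

/-- A trivialization which is given by `A_{M,L} • F_{M,L}` for pairs in general position. -/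
structure IsCanonicalSystem (T : System ψ V) : Prop extends IsTrivialization ψ T where
  eq_ansatz : ∀ M L : OLag V, GeneralPosition M L →
    T M L = normConst ψ M L • averaging ψ M L

theorem IsCanonicalSystem.unique {T T' : System ψ V} (h : IsCanonicalSystem ψ T)
    (h' : IsCanonicalSystem ψ T') : T = T' := by
  funext N L
  obtain ⟨S, h1, h2⟩ := OLag.exists_generalPosition N L
  rw [← h.mul N S L, ← h'.mul N S L, h.eq_ansatz N S h1, h.eq_ansatz S L h2,
    h'.eq_ansatz N S h1, h'.eq_ansatz S L h2]

open Classical in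
/-- The canonical intertwining morphisms `T_{M,L}`: the unique trivialization extending the
explicit formula for pairs in general position. -/
def canonicalSystem (V : SympSpace.{u, v} F) : System ψ V :=
  if h : ∃ T : System ψ V, IsCanonicalSystem ψ T then h.choose else fun _ _ => 0

theorem canonicalSystem_eq {T : System ψ V} (h : IsCanonicalSystem ψ T) :
    canonicalSystem ψ V = T := by
  have hex : ∃ T : System ψ V, IsCanonicalSystem ψ T := ⟨T, h⟩
  unfold canonicalSystem
  rw [dif_pos hex]
  exact hex.choose_spec.unique ψ h

/-- The canonical vector space `ℋ(V)` of horizontal sections. -/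
def canonicalSpace (V : SympSpace.{u, v} F) :
    Submodule ℂ (∀ L : OLag V, model ψ L.space) where
  carrier := {s | ∀ M L : OLag V, canonicalSystem ψ V M L (s L) = s M}
  zero_mem' := fun _ _ => map_zero _
  add_mem' := by
    intro s t hs ht M L
    rw [Pi.add_apply, map_add, hs M L, ht M L]; rfl
  smul_mem' := by
    intro c s hs M L
    rw [Pi.smul_apply, map_smul, hs M L]; rfl

/-! ### Functoriality -/

/-- Transport of a system along a symplectic isomorphism. -/
def System.pullback (f : SympIso V U) (T : System ψ U) : System ψ V := fun M L =>
  (pull ψ f M).toLinearMap ∘ₗ T (M.map f) (L.map f) ∘ₗ (pull ψ f L).symm.toLinearMap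

theorem normConst_map (f : SympIso V U) (M L : OLag V) :
    normConst ψ (M.map f) (L.map f) = normConst ψ M L := by
  unfold normConst
  rw [omegaWedge_vecPower_map, ← f.halfDim_eq]

theorem pull_averaging (f : SympIso V U) (M L : OLag V) (φ : model ψ (L.map f).space) :
    pull ψ f M (averaging ψ (M.map f) (L.map f) φ) = averaging ψ M L (pull ψ f L φ) := by
  apply Subtype.ext; funext h
  symm
  refine Fintype.sum_equiv (f.toLinearEquiv.submoduleMap M.space).toEquiv _ _ fun m => ?_
  change φ.1 (Heis.map f (Heis.ofVec (m : V) * h)) = _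
  rw [Heis.map_mul]
  rfl

theorem IsCanonicalSystem.pullback (f : SympIso V U) {T : System ψ U}
    (h : IsCanonicalSystem ψ T) : IsCanonicalSystem ψ (System.pullback ψ f T) where
  intertwining M L g φ := by
    obtain ⟨χ, rfl⟩ := (pull ψ f L).surjective φ
    simp only [System.pullback, LinearMap.comp_apply, LinearEquiv.coe_coe]
    rw [← pull_modelRep]
    simp only [LinearEquiv.symm_apply_apply]
    rw [h.intertwining, pull_modelRep]
  bijective M L := by
    simp only [System.pullback, LinearMap.coe_comp, LinearEquiv.coe_coe]
    exact (pull ψ f M).bijective.comp ((h.bijective _ _).comp (pull ψ f L).symm.bijective)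
  mul N M L := by
    apply LinearMap.ext; intro φ
    simp only [System.pullback, LinearMap.comp_apply, LinearEquiv.coe_coe,
      LinearEquiv.symm_apply_apply]
    rw [← h.mul (N.map f) (M.map f) (L.map f)]
    rfl
  eq_ansatz M L hML := by
    apply LinearMap.ext; intro φ
    obtain ⟨χ, rfl⟩ := (pull ψ f L).surjective φ
    have hg : GeneralPosition (M.map f) (L.map f) := by
      change M.space.map _ ⊔ L.space.map _ = ⊤
      rw [← Submodule.map_sup, show M.space ⊔ L.space = ⊤ from hML, Submodule.map_top]
      exact LinearMap.range_eq_top.mpr f.toLinearEquiv.surjective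
    simp only [System.pullback, LinearMap.comp_apply, LinearEquiv.coe_coe,
      LinearEquiv.symm_apply_apply]
    rw [h.eq_ansatz _ _ hg, LinearMap.smul_apply, map_smul, pull_averaging, normConst_map]
    rfl

theorem canonicalSystem_map (f : SympIso V U) (M L : OLag V) (φ : model ψ (L.map f).space) :
    canonicalSystem ψ V M L (pull ψ f L φ) =
      pull ψ f M (canonicalSystem ψ U (M.map f) (L.map f) φ) := by
  by_cases hex : ∃ T : System ψ U, IsCanonicalSystem ψ T
  · obtain ⟨T, hT⟩ := hex
    rw [canonicalSystem_eq ψ hT, canonicalSystem_eq ψ (hT.pullback ψ f)]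
    simp [System.pullback]
  · have hex' : ¬ ∃ T : System ψ V, IsCanonicalSystem ψ T := by
      rintro ⟨T, hT⟩
      exact hex ⟨_, hT.pullback ψ f.symm⟩
    unfold canonicalSystem
    rw [dif_neg hex, dif_neg hex']
    simp

/-- The map `ℋ(f) : ℋ(U) → ℋ(V)` induced by a symplectic isomorphism `f : V → U`. -/
def quant (f : SympIso V U) : canonicalSpace ψ U →ₗ[ℂ] canonicalSpace ψ V where
  toFun s := ⟨fun L => pull ψ f L (s.1 (L.map f)), fun M L => by
    rw [canonicalSystem_map, s.2]⟩
  map_add' s t := by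
    apply Subtype.ext; funext L; exact map_add (pull ψ f L) _ _
  map_smul' c s := by
    apply Subtype.ext; funext L; exact map_smul (pull ψ f L) _ _

theorem quant_refl : quant ψ (SympIso.refl V) = LinearMap.id := by
  apply LinearMap.ext; intro s; apply Subtype.ext; funext L; apply Subtype.ext; funext h
  exact section_congr ψ s.1 (OLag.map_refl L) h

theorem quant_trans (f : SympIso V U) (g : SympIso U W) :
    quant ψ (f.trans g) = quant ψ f ∘ₗ quant ψ g := by
  apply LinearMap.ext; intro s; apply Subtype.ext; funext L; apply Subtype.ext; funext h
  exact section_congr ψ s.1 (OLag.map_trans f g L) _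

/-- The canonical model of the Weil representation, `ρ_V(g) = ℋ(g⁻¹)`. -/
def weilRep (V : SympSpace.{u, v} F) : Representation ℂ (SympIso V V) (canonicalSpace ψ V) where
  toFun g := quant ψ g⁻¹
  map_one' := by rw [inv_one]; exact quant_refl ψ
  map_mul' g h := by
    rw [mul_inv_rev]
    exact quant_trans ψ g⁻¹ h⁻¹

/-! ### The Heisenberg action and invariants -/

theorem canonicalSystem_modelRep (M L : OLag V) (g : Heis V) (φ : model ψ L.space) :
    canonicalSystem ψ V M L (modelRep ψ L.space g φ) =
      modelRep ψ M.space g (canonicalSystem ψ V M L φ) := by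
  by_cases hex : ∃ T : System ψ V, IsCanonicalSystem ψ T
  · obtain ⟨T, hT⟩ := hex
    rw [canonicalSystem_eq ψ hT, hT.intertwining]
  · unfold canonicalSystem
    rw [dif_neg hex]
    simp

/-- The action of the Heisenberg group on `ℋ(V)`, induced by the action on the fibers. -/
def heisRep (V : SympSpace.{u, v} F) : Representation ℂ (Heis V) (canonicalSpace ψ V) where
  toFun g :=
    { toFun := fun s => ⟨fun L => modelRep ψ L.space g (s.1 L), fun M L => by
        rw [canonicalSystem_modelRep, s.2]⟩
      map_add' := fun s t => by
        apply Subtype.ext; funext L; exact map_add (modelRep ψ L.space g) _ _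
      map_smul' := fun c s => by
        apply Subtype.ext; funext L; exact map_smul (modelRep ψ L.space g) _ _ }
  map_one' := by
    apply LinearMap.ext; intro s; apply Subtype.ext; funext L
    exact LinearMap.congr_fun (map_one (modelRep ψ L.space)) (s.1 L)
  map_mul' g h := by
    apply LinearMap.ext; intro s; apply Subtype.ext; funext L
    exact LinearMap.congr_fun (map_mul (modelRep ψ L.space) g h) (s.1 L)

/-- The subspace `ℋ(V)^I` of vectors invariant under `I ⊂ H(V)`. -/
def invariantSpace (I : Submodule F V) : Submodule ℂ (canonicalSpace ψ V) where
  carrier := {s | ∀ i ∈ I, heisRep ψ V (Heis.ofVec i) s = s}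
  zero_mem' := fun _ _ => map_zero _
  add_mem' := by
    intro s t hs ht i hi
    rw [map_add, hs i hi, ht i hi]
  smul_mem' := by
    intro c s hs i hi
    rw [map_smul, hs i hi]

theorem quant_mem_invariantSpace (f : SympIso V U) {I : OIso V} {J : OIso U}
    (hf : I.map f = J) {s : canonicalSpace ψ U} (hs : s ∈ invariantSpace ψ J.space) :
    quant ψ f s ∈ invariantSpace ψ I.space := by
  subst hf
  intro i hi
  have h := hs (f.toLinearEquiv i) (Submodule.mem_map_of_mem hi)
  conv_rhs => rw [← h]
  apply Subtype.ext; funext L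
  exact (pull_modelRep ψ f L (Heis.ofVec i) (s.1 (L.map f))).symm

/-- The restriction of `ℋ(f)` to a map `ℋ(U)^J → ℋ(V)^I`, when `f(I°) = J°`. -/
def quantInvariant (f : SympIso V U) {I : OIso V} {J : OIso U} (hf : I.map f = J) :
    invariantSpace ψ J.space →ₗ[ℂ] invariantSpace ψ I.space :=
  (quant ψ f).restrict fun _ hs => quant_mem_invariantSpace ψ f hf hs

end FiniteField

/-! ### Symplectic reduction -/

section Reduction

variable {F : Type u} [Field F] {V U : SympSpace.{u, v} F}

/-- The form on `I^⊥`, as a map to the dual of `I^⊥ / I`. -/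
def redFormAux (I : OIso V) : V.perp I.space →ₗ[F]
    (V.perp I.space ⧸ I.space.submoduleOf (V.perp I.space)) →ₗ[F] F where
  toFun x := (I.space.submoduleOf (V.perp I.space)).liftQ
    ((V.form x).comp (V.perp I.space).subtype) (by
      intro y hy
      change V.form (x : V) (y : V) = 0
      rw [V.form_swap (x : V) (y : V)]
      exact neg_eq_zero.mpr (x.2 _ hy))
  map_add' x y := by
    apply LinearMap.ext; intro z
    obtain ⟨z, rfl⟩ := Submodule.Quotient.mk_surjective _ z
    simp
  map_smul' c x := by
    apply LinearMap.ext; intro z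
    obtain ⟨z, rfl⟩ := Submodule.Quotient.mk_surjective _ z
    simp

/-- The form on `I^⊥ / I` induced by the symplectic form. -/
def redForm (I : OIso V) :
    LinearMap.BilinForm F (V.perp I.space ⧸ I.space.submoduleOf (V.perp I.space)) :=
  (I.space.submoduleOf (V.perp I.space)).liftQ (redFormAux I) (by
    intro x hx
    apply LinearMap.ext; intro z
    obtain ⟨z, rfl⟩ := Submodule.Quotient.mk_surjective _ z
    exact z.2 _ hx)

theorem redForm_mk (I : OIso V) (x y : V.perp I.space) :
    redForm I (Submodule.Quotient.mk x) (Submodule.Quotient.mk y) = V.form x y := rfl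

theorem redForm_isAlt (I : OIso V) : (redForm I).IsAlt := by
  intro x
  obtain ⟨x, rfl⟩ := Submodule.Quotient.mk_surjective _ x
  exact V.isAlt.self_eq_zero _

/-- The symplectic reduction `I^⊥ / I`. -/
def reduction (V : SympSpace.{u, v} F) (I : OIso V) : SympSpace.{u, v} F where
  carrier := V.perp I.space ⧸ I.space.submoduleOf (V.perp I.space)
  form := redForm I
  isAlt := redForm_isAlt I
  nondegenerate := by
    have key : ∀ x, (∀ y, redForm I y x = 0) → x = 0 := by
      intro x hx
      obtain ⟨x, rfl⟩ := Submodule.Quotient.mk_surjective _ x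
      rw [Submodule.Quotient.mk_eq_zero]
      have : (x : V) ∈ V.perp (V.perp I.space) := fun y hy => hx (Submodule.Quotient.mk ⟨y, hy⟩)
      rw [V.perp_perp] at this
      exact this
    refine ⟨fun x hx => key x fun y => ?_, key⟩
    rw [← (redForm_isAlt I).neg_eq x y, hx y, neg_zero]

/-- The map `f_I : I^⊥ / I → J^⊥ / J` induced by `f : V → U` with `f(I°) = J°`. -/
def reductionMap (f : SympIso V U) {I : OIso V} {J : OIso U} (hf : I.map f = J) :
    SympIso (reduction V I) (reduction U J) where
  toLinearEquiv := Submodule.Quotient.equiv _ _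
    (f.toLinearEquiv.ofSubmodules (V.perp I.space) (U.perp J.space)
      (by subst hf; exact f.map_perp I.space))
    (by
      subst hf
      ext x
      constructor
      · rintro ⟨y, hy, rfl⟩
        exact ⟨(y : V), hy, rfl⟩
      · rintro ⟨y, hy, hyx⟩
        exact ⟨⟨y, I.isotropic hy⟩, hy, Subtype.ext hyx⟩)
  map_form x y := by
    obtain ⟨x, rfl⟩ := Submodule.Quotient.mk_surjective _ x
    obtain ⟨y, rfl⟩ := Submodule.Quotient.mk_surjective _ y
    exact f.form_apply x y

/-- The subgroup `P ⊂ Sp(V)` of elements `g` with `g(I°) = I°`. -/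
def stabilizer (I : OIso V) : Subgroup (SympIso V V) where
  carrier := {g | I.map g = I}
  one_mem' := I.map_refl
  mul_mem' := by
    intro g h hg hh
    change I.map (h.trans g) = I
    rw [OIso.map_trans, show I.map h = I from hh, show I.map g = I from hg]
  inv_mem' := by
    intro g hg
    change I.map g.symm = I
    have h1 : I.map (g.trans g.symm) = I.map g.symm := by
      rw [OIso.map_trans, show I.map g = I from hg]
    have h2 : g.trans g.symm = SympIso.refl V := inv_mul_cancel g
    rw [← h1, h2, OIso.map_refl]

/-- The canonical homomorphism `π : P → Sp(I^⊥ / I)`. -/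
def stabilizerHom (I : OIso V) :
    stabilizer I →* SympIso (reduction V I) (reduction V I) where
  toFun g := reductionMap g.1 g.2
  map_one' := by
    apply SympIso.ext; intro x
    obtain ⟨x, rfl⟩ := Submodule.Quotient.mk_surjective _ x
    rfl
  map_mul' g h := by
    apply SympIso.ext; intro x
    obtain ⟨x, rfl⟩ := Submodule.Quotient.mk_surjective _ x
    rfl

end Reduction

section Restriction

variable {F : Type u} [Field F] [Fintype F] [DecidableEq F]
variable (ψ : AddChar F ℂ) {V : SympSpace.{u, v} F}

theorem weilRep_mem_invariantSpace (I : OIso V) (g : stabilizer I) {s : canonicalSpace ψ V}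
    (hs : s ∈ invariantSpace ψ I.space) : weilRep ψ V g.1 s ∈ invariantSpace ψ I.space :=
  quant_mem_invariantSpace ψ g.1⁻¹ (g⁻¹).2 hs

/-- The representation of `P` on `ℋ(V)^I` obtained by restricting the Weil representation. -/
def weilRepInvariant (I : OIso V) :
    Representation ℂ (stabilizer I) (invariantSpace ψ I.space) where
  toFun g := (weilRep ψ V g.1).restrict fun _ hs => weilRep_mem_invariantSpace ψ I g hs
  map_one' := by
    apply LinearMap.ext; intro s; apply Subtype.ext
    exact LinearMap.congr_fun (map_one (weilRep ψ V)) s.1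
  map_mul' g h := by
    apply LinearMap.ext; intro s; apply Subtype.ext
    exact LinearMap.congr_fun (map_mul (weilRep ψ V) g.1 h.1) s.1

end Restriction

end Quantization

end

/-! An intertwiner between two models is determined by one number, so every identity between
intertwiners becomes an identity between numbers. Let δ_L be the `L`-invariant function in ℋ_L
supported on `L × F`. Its translates span ℋ_L, and an `L`-invariant vector of ℋ_N is determined by
its value at 1. Hence `T : ℋ_L → ℋ_N` is known once `(T δ_L)(1)` is (`intertwiner_ext`, which plays
the role of Schur's lemma).

For existence, `T_{N,L}` is the composite of the prescribed maps through a Lagrangian `S`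
transversal to both. With `p` the projection to `L` along `S`, its number is, up to normalization,
the sum of ψ(½ω(pn, n)) over `n ∈ N`. This is the Gauss sum of a quadratic form on `N` with radical
`L ∩ N`. Write `i = dim (L ∩ N)`, let `r` be the codimension of `L ∩ N` in `L`, and extend a basis
of `L ∩ N` by vectors `k` to `L` and `m` to `N`. Since G₁² = σ(-1)q, the number becomes (G₁/q)^r
σ(ab det ω(k, m)), where `a`, `b` are the orientations in these bases (`ansatz_comp_delta`). All
traces of `S` occur squared and disappear, so the composite does not depend on `S`. The case `r = 0`
gives invertibility, the case `i = 0` gives the prescribed formula, and a Lagrangian transversal to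
three given ones gives multiplicativity. Uniqueness holds because any two Lagrangians have a common
transversal.

For reduction, a Lagrangian `N` of `I^⊥/I` is lifted to its preimage in `I^⊥`, oriented by `o_I ∧
o_N`. An `I`-invariant function in the model of such a lift vanishes off `I^⊥ × F` and descends to
`I^⊥/I`, which identifies the invariants with the model of `N`. Lifts of transversal Lagrangians
meet exactly in `I`, and the formula above, which covers non-transversal pairs, gives the
normalization for `I^⊥/I`, as `o_I` enters squared. Thus the canonical system of `V` induces that of
`I^⊥/I` (`isCanonicalSystem_reducedSystem`), and horizontal sections correspond. Naturality holds
because lifting commutes with symplectic isomorphisms, orientations included (`liftOLag_map`);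
equivariance under `P` is naturality for `g⁻¹`. -/

noncomputable section
namespace Quantization

/-! ### Gauss sums of quadratic forms over a finite field -/

section GaussSums

theorem addChar_sum {ι A M : Type*} [AddCommMonoid A] [CommMonoid M] (ψ : AddChar A M)
    (s : Finset ι) (f : ι → A) :
    ψ (∑ i ∈ s, f i) = ∏ i ∈ s, ψ (f i) := by
  classical
  induction s using Finset.induction_on with
  | empty => simp
  | insert a s ha ih => rw [Finset.sum_insert ha, Finset.prod_insert ha, AddChar.map_add_eq_mul, ih]

variable {F : Type u} [Field F] [Fintype F] [DecidableEq F]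

/-- An element `t` has 1 + σ(t) square roots. The constant 1 contributes a full character sum, which
vanishes, and rescaling by `b` in the remaining Gauss sum of σ produces σ(b). -/
theorem sum_addChar_mul_sq_eq_gaussSum (hF : ringChar F ≠ 2) {ψ : AddChar F ℂ} (hψ : ψ ≠ 1)
    {b : F} (hb : b ≠ 0) :
    ∑ x : F, ψ (b * x ^ 2) =
      quadraticChar F b * gaussSum ((quadraticChar F).ringHomComp (Int.castRingHom ℂ)) ψ := by
  have hsum : ∑ t : F, ψ (b * t) = 0 := by
    have := AddChar.sum_eq_zero_of_ne_one (AddChar.IsPrimitive.of_ne_one hψ hb)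
    simpa [AddChar.mulShift_apply] using this
  have h1 : ∑ x : F, ψ (b * x ^ 2) = ∑ t : F, ((quadraticChar F t : ℤ) + 1 : ℂ) * ψ (b * t) := by
    rw [← Finset.sum_fiberwise Finset.univ (fun x : F => x ^ 2)]
    refine Finset.sum_congr rfl fun t _ => ?_
    rw [Finset.sum_congr rfl (g := fun _ => ψ (b * t))
      (fun x hx => by rw [(Finset.mem_filter.mp hx).2]), Finset.sum_const, nsmul_eq_mul]
    congr 1
    have h := quadraticChar_card_sqrts hF t
    have h2 : (Finset.univ.filter fun x : F => x ^ 2 = t) = {x : F | x ^ 2 = t}.toFinset := by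
      ext; simp
    rw [h2]
    exact_mod_cast congrArg (Int.cast : ℤ → ℂ) h
  have h3 := gaussSum_mulShift ((quadraticChar F).ringHomComp (Int.castRingHom ℂ)) ψ
    (Units.mk0 b hb)
  have hsq : ((quadraticChar F b : ℤ) : ℂ) * (quadraticChar F b : ℤ) = 1 := by
    have := quadraticChar_sq_one hb
    rw [sq] at this
    exact_mod_cast this
  have h4 : ∑ x : F, ψ (b * x ^ 2) =
      gaussSum ((quadraticChar F).ringHomComp (Int.castRingHom ℂ)) (AddChar.mulShift ψ b) := by
    rw [h1]
    simp only [add_mul, one_mul, Finset.sum_add_distrib, hsum, add_zero]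
    rfl
  rw [h4, ← h3, ← mul_assoc]
  change _ = ((quadraticChar F b : ℤ) : ℂ) * (quadraticChar F b : ℤ) * _
  rw [hsq, one_mul]
  rfl

theorem sum_addChar_half_mul_sq (hF : ringChar F ≠ 2) {ψ : AddChar F ℂ} (hψ : ψ ≠ 1)
    {a : F} (ha : a ≠ 0) :
    ∑ x : F, ψ (2⁻¹ * (a * x ^ 2)) = quadraticChar F a * gaussSumOne ψ := by
  have h2 : (2⁻¹ : F) ≠ 0 := inv_ne_zero (Ring.two_ne_zero hF)
  unfold gaussSumOne
  rw [sum_addChar_mul_sq_eq_gaussSum hF hψ h2]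
  simp_rw [← mul_assoc]
  rw [sum_addChar_mul_sq_eq_gaussSum hF hψ (mul_ne_zero h2 ha), map_mul]
  push_cast
  ring

theorem gaussSumOne_sq (hF : ringChar F ≠ 2) {ψ : AddChar F ℂ} (hψ : ψ ≠ 1) :
    gaussSumOne ψ ^ 2 = quadraticChar F (-1) * (Fintype.card F : ℂ) := by
  have h2 : (2⁻¹ : F) ≠ 0 := inv_ne_zero (Ring.two_ne_zero hF)
  have hsq : ((quadraticChar F 2⁻¹ : ℤ) : ℂ) ^ 2 = 1 := by
    exact_mod_cast quadraticChar_sq_one h2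
  have hprim : ψ.IsPrimitive := AddChar.IsPrimitive.of_ne_one hψ
  have hinj : Function.Injective (Int.castRingHom ℂ) := Int.cast_injective
  unfold gaussSumOne
  rw [sum_addChar_mul_sq_eq_gaussSum hF hψ h2, mul_pow, hsq, one_mul,
    gaussSum_sq ((MulChar.ringHomComp_ne_one_iff hinj).mpr (quadraticChar_ne_one hF))
      ((quadraticChar_isQuadratic F).comp _) hprim]
  rfl

/-- In an orthogonal basis the sum is a product of one-dimensional ones. The change of basis
multiplies the determinant by a square, which σ does not see. -/
theorem sum_addChar_half_quadratic (hF : ringChar F ≠ 2) {ψ : AddChar F ℂ} (hψ : ψ ≠ 1)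
    {r : ℕ} (A : Matrix (Fin r) (Fin r) F) (hA : A.IsSymm) (hdet : A.det ≠ 0) :
    ∑ x : Fin r → F, ψ (2⁻¹ * (x ⬝ᵥ A.mulVec x)) =
      gaussSumOne ψ ^ r * quadraticChar F A.det := by
  have : Invertible (2 : F) := invertibleOfNonzero (Ring.two_ne_zero hF)
  obtain ⟨v, hv⟩ := LinearMap.BilinForm.exists_orthogonal_basis
    (B := Matrix.toBilin' A) (by
      constructor
      intro x y
      simp only [Matrix.toBilin'_apply', RingHom.id_apply]
      rw [Matrix.dotProduct_mulVec, ← Matrix.mulVec_transpose, hA, dotProduct_comm])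
  let w : Module.Basis (Fin r) F (Fin r → F) := v.reindex (finCongr (by simp))
  have hw : ∀ i j, i ≠ j → w i ⬝ᵥ A.mulVec (w j) = 0 := by
    intro i j hij
    have := hv (i := (finCongr (by simp)).symm i) (j := (finCongr (by simp)).symm j)
      (by simpa using hij)
    simpa [Matrix.toBilin'_apply', w] using this
  let P : Matrix (Fin r) (Fin r) F := Matrix.of fun i j => w j i
  let d : Fin r → F := fun i => w i ⬝ᵥ A.mulVec (w i)
  have hPAP : P.transpose * A * P = Matrix.diagonal d := by
    ext i j
    have e : (P.transpose * A * P) i j = w i ⬝ᵥ A.mulVec (w j) := by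
      rw [Matrix.mul_assoc]
      rfl
    rw [e]
    by_cases hij : i = j
    · subst hij; simp [d]
    · rw [hw i j hij, Matrix.diagonal_apply_ne _ hij]
  have hP : P.det ≠ 0 := by
    have h1 : P = (Pi.basisFun F (Fin r)).toMatrix w := by
      ext i j; simp [P, Module.Basis.toMatrix_apply]
    intro h0
    have h2 := (Pi.basisFun F (Fin r)).toMatrix_mul_toMatrix_flip w
    have h3 := congrArg Matrix.det h2
    rw [Matrix.det_mul, ← h1, h0, zero_mul, Matrix.det_one] at h3
    exact zero_ne_one h3
  have hdd : ∏ i, d i = P.det ^ 2 * A.det := by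
    rw [← Matrix.det_diagonal, ← hPAP, Matrix.det_mul, Matrix.det_mul, Matrix.det_transpose]
    ring
  have hd : ∀ i, d i ≠ 0 := by
    have : ∏ i, d i ≠ 0 := by rw [hdd]; exact mul_ne_zero (pow_ne_zero _ hP) hdet
    intro i
    exact Finset.prod_ne_zero_iff.mp this i (Finset.mem_univ _)
  have hexp : ∀ y : Fin r → F, w.equivFun.symm y ⬝ᵥ A.mulVec (w.equivFun.symm y) =
      ∑ i, d i * y i ^ 2 := by
    intro y
    have e : w.equivFun.symm y = P.mulVec y := by
      rw [Module.Basis.equivFun_symm_apply]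
      ext i
      simp [Matrix.mulVec, dotProduct, P, mul_comm]
    rw [e, Matrix.dotProduct_mulVec, Matrix.vecMul_mulVec, ← Matrix.dotProduct_mulVec,
      Matrix.mulVec_mulVec, hPAP]
    simp only [dotProduct, Matrix.mulVec_diagonal]
    refine Finset.sum_congr rfl fun i _ => ?_
    ring
  rw [← Equiv.sum_comp w.equivFun.symm.toEquiv]
  have h5 : ∀ y : Fin r → F, ψ (2⁻¹ * (w.equivFun.symm y ⬝ᵥ A.mulVec (w.equivFun.symm y))) =
      ∏ i, ψ (2⁻¹ * (d i * y i ^ 2)) := by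
    intro y
    rw [hexp, Finset.mul_sum, addChar_sum]
  simp only [LinearEquiv.coe_toEquiv, h5]
  rw [← Fintype.prod_sum (fun i (t : F) => ψ (2⁻¹ * (d i * t ^ 2)))]
  simp only [sum_addChar_half_mul_sq hF hψ (hd _), Finset.prod_mul_distrib, Finset.prod_const,
    Finset.card_univ, Fintype.card_fin]
  have h6 : ∏ i, ((quadraticChar F (d i) : ℤ) : ℂ) = (quadraticChar F A.det : ℤ) := by
    rw [← Int.cast_prod, ← map_prod, hdd, map_mul, quadraticChar_sq_one' hP, one_mul]
  rw [h6, mul_comm]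

end GaussSums

/-! ### Rigidity of intertwiners between models -/

section Schur

variable {F : Type u} [Field F] (ψ : AddChar F ℂ) {V : SympSpace.{u, v} F}

theorem Heis.mul_ofVec (h2 : (2 : F) ≠ 0) (h : Heis V) (x : V) :
    h * Heis.ofVec x = Heis.ofCen V (V.form h.vec x) * (Heis.ofVec x * h) := by
  apply Heis.ext
  · change h.vec + x = 0 + (x + h.vec)
    rw [zero_add, add_comm]
  · change h.cen + 0 + 2⁻¹ * V.form h.vec x = V.form h.vec x + (0 + h.cen + 2⁻¹ * V.form x h.vec)
      + 2⁻¹ * V.form 0 (x + h.vec)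
    rw [V.form_swap x h.vec, map_zero, LinearMap.zero_apply]
    field_simp
    ring

theorem perp_sup (N L : Submodule F V) : V.perp (N ⊔ L) = V.perp N ⊓ V.perp L := by
  apply le_antisymm
  · exact le_inf (V.perp_anti le_sup_left) (V.perp_anti le_sup_right)
  · rintro x ⟨h1, h2⟩ y hy
    obtain ⟨a, ha, b, hb, rfl⟩ := Submodule.mem_sup.mp hy
    rw [map_add, LinearMap.add_apply, h1 a ha, h2 b hb, add_zero]

/-- An element `i` of `I` fixes `f` both from the left, as `I ≤ L`, and from the right, by
invariance. The two translates differ by ψ(ω(h, i)), so `f` vanishes wherever this can be made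
different from 1. -/
theorem apply_eq_zero_of_not_mem_perp (h2 : (2 : F) ≠ 0) (hψ : ψ ≠ 1) {L I : Submodule F V}
    (hIL : I ≤ L) (f : model ψ L) (hf : ∀ i ∈ I, modelRep ψ L (Heis.ofVec i) f = f)
    {h : Heis V} (hh : h.vec ∉ V.perp I) : f.1 h = 0 := by
  have hex : ∃ i ∈ I, V.form i h.vec ≠ 0 := by
    by_contra hcon
    push Not at hcon
    exact hh hcon
  obtain ⟨i, hi, hne⟩ := hex
  obtain ⟨t, ht⟩ : ∃ t, ψ t ≠ 1 := by
    by_contra hcon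
    push Not at hcon
    exact hψ (by ext t; exact hcon t)
  have hne' : V.form h.vec i ≠ 0 := by rw [V.form_swap]; exact neg_ne_zero.mpr hne
  -- The multiple of `i` is chosen so that `h.vec` pairs with it to `t`.
  have hmem : (t * (V.form h.vec i)⁻¹) • i ∈ I := I.smul_mem _ hi
  have e1 : f.1 (h * Heis.ofVec ((t * (V.form h.vec i)⁻¹) • i)) = f.1 h :=
    congrFun (congrArg Subtype.val (hf _ hmem)) h
  rw [Heis.mul_ofVec h2, f.2.1, f.2.2 _ (hIL hmem), map_smul, smul_eq_mul,
    mul_assoc, inv_mul_cancel₀ hne', mul_one] at e1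
  by_contra h0
  exact ht (mul_right_cancel₀ h0 (e1.trans (one_mul _).symm))

open Classical in
/-- The function supported on `L × F` which is invariant under `L`. -/
def deltaModel (L : Submodule F V) (hL : L ≤ V.perp L) : model ψ L :=
  ⟨fun h => if h.vec ∈ L then ψ h.cen else 0, by
    refine ⟨fun z h => ?_, fun l hl h => ?_⟩
    · have e1 : (Heis.ofCen V z * h).vec = h.vec := zero_add _
      have e2 : (Heis.ofCen V z * h).cen = z + h.cen := by
        simp [Heis.mul_def, Heis.ofCen]
      beta_reduce
      rw [e1, e2, mul_ite, mul_zero, AddChar.map_add_eq_mul]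
    · have e1 : (Heis.ofVec l * h).vec = l + h.vec := rfl
      beta_reduce
      rw [e1, Submodule.add_mem_iff_right L hl]
      by_cases hh : h.vec ∈ L
      · have e2 : V.form l h.vec = 0 := hL hh l hl
        simp [Heis.mul_def, Heis.ofVec, e2]
      · rw [if_neg hh, if_neg hh]⟩

theorem deltaModel_of_mem {L : Submodule F V} (hL : L ≤ V.perp L) {h : Heis V} (hh : h.vec ∈ L) :
    (deltaModel ψ L hL).1 h = ψ h.cen := if_pos hh

theorem deltaModel_of_notMem {L : Submodule F V} (hL : L ≤ V.perp L) {h : Heis V}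
    (hh : h.vec ∉ L) : (deltaModel ψ L hL).1 h = 0 := if_neg hh

theorem modelRep_deltaModel {L : Submodule F V} (hL : L ≤ V.perp L) {l : V} (hl : l ∈ L) :
    modelRep ψ L (Heis.ofVec l) (deltaModel ψ L hL) = deltaModel ψ L hL := by
  apply Subtype.ext; funext h
  change (deltaModel ψ L hL).1 (h * Heis.ofVec l) = _
  have e1 : (h * Heis.ofVec l).vec = h.vec + l := rfl
  by_cases hh : h.vec ∈ L
  · rw [deltaModel_of_mem ψ hL hh, deltaModel_of_mem ψ hL (L.add_mem hh hl)]
    have e2 : V.form h.vec l = 0 := hL hl _ hh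
    simp [Heis.mul_def, Heis.ofVec, e2]
  · rw [deltaModel_of_notMem ψ hL hh, deltaModel_of_notMem ψ hL]
    rwa [e1, Submodule.add_mem_iff_left L hl]

/-- On `N + L` the value at 1 propagates, by `N` from the left and by `L` from the right. Since `N +
L` is the orthogonal complement of the isotropic space `N ∩ L`, which fixes `f` from both sides, `f`
vanishes elsewhere. -/
theorem eq_zero_of_invariant (h2 : (2 : F) ≠ 0) (hψ : ψ ≠ 1) {N L : Submodule F V}
    (hN : V.perp N = N) (hL : V.perp L = L) (f : model ψ N)
    (hf : ∀ l ∈ L, modelRep ψ N (Heis.ofVec l) f = f) (h1 : f.1 1 = 0) : f = 0 := by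
  apply Subtype.ext; funext h
  by_cases hh : h.vec ∈ N ⊔ L
  · obtain ⟨n, hn, l, hl, hnl⟩ := Submodule.mem_sup.mp hh
    have e : h = Heis.ofCen V (h.cen - 2⁻¹ * V.form n l) * (Heis.ofVec n * (1 * Heis.ofVec l)) := by
      rw [one_mul]
      apply Heis.ext
      · simp [Heis.mul_def, Heis.ofVec, Heis.ofCen, hnl]
      · simp [Heis.mul_def, Heis.ofVec, Heis.ofCen]
    rw [e, f.2.1, f.2.2 n hn]
    have := congrFun (congrArg Subtype.val (hf l hl)) 1
    change f.1 (1 * Heis.ofVec l) = f.1 1 at this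
    rw [this, h1, mul_zero]
    rfl
  · refine apply_eq_zero_of_not_mem_perp ψ h2 hψ (I := N ⊓ L) inf_le_left f
      (fun i hi => hf i hi.2) fun hmem => hh ?_
    have : N ⊓ L = V.perp (N ⊔ L) := by rw [perp_sup, hN, hL]
    rwa [this, V.perp_perp] at hmem

variable [Fintype F]

/-- At `h`, the term of `x` equals `f h` if `h.vec - x ∈ L` and 0 otherwise, so `f h` is counted
once for each element of `L`. In particular the translates of δ_L span the model. -/
theorem model_eq_sum_deltaModel [Fintype V] {L : Submodule F V} (hL : L ≤ V.perp L)
    (f : model ψ L) :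
    (Fintype.card L : ℂ) • f =
      ∑ x : V, f.1 (Heis.ofVec x) • modelRep ψ L (Heis.ofVec (-x)) (deltaModel ψ L hL) := by
  apply Subtype.ext; funext h
  have hsum : (∑ x : V, f.1 (Heis.ofVec x) •
      modelRep ψ L (Heis.ofVec (-x)) (deltaModel ψ L hL)).1 h =
      ∑ x : V, f.1 (Heis.ofVec x) * (deltaModel ψ L hL).1 (h * Heis.ofVec (-x)) := by
    rw [Submodule.coe_sum, Finset.sum_apply]
    rfl
  rw [hsum]
  have hterm : ∀ x : V, f.1 (Heis.ofVec x) * (deltaModel ψ L hL).1 (h * Heis.ofVec (-x)) =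
      Set.indicator {x : V | h.vec - x ∈ L} (fun _ => f.1 h) x := by
    intro x
    have hv : (h * Heis.ofVec (-x)).vec = h.vec - x := (sub_eq_add_neg _ _).symm
    by_cases hx : h.vec - x ∈ L
    · rw [Set.indicator_of_mem (by exact hx), deltaModel_of_mem ψ hL (by rwa [hv])]
      have e : h = Heis.ofCen V (h * Heis.ofVec (-x)).cen *
          (Heis.ofVec (h.vec - x) * Heis.ofVec x) := by
        apply Heis.ext
        · simp [Heis.mul_def, Heis.ofVec, Heis.ofCen]
        · simp [Heis.mul_def, Heis.ofVec, Heis.ofCen, V.isAlt.self_eq_zero]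
      conv_rhs => rw [e]
      rw [f.2.1, f.2.2 _ hx, mul_comm]
    · rw [Set.indicator_of_notMem (by exact hx), deltaModel_of_notMem ψ hL (by rwa [hv]), mul_zero]
  classical
  simp only [hterm, Set.indicator_apply, Finset.sum_ite, Finset.sum_const_zero, add_zero,
    Finset.sum_const, nsmul_eq_mul]
  change (Fintype.card L : ℂ) * f.1 h = _
  congr 2
  rw [← Finset.card_univ]
  refine Finset.card_bij (fun l _ => h.vec - l) (fun l _ => ?_) (fun a _ b _ hab => ?_)
    fun x hx => ⟨⟨h.vec - x, (Finset.mem_filter.mp hx).2⟩, Finset.mem_univ _, sub_sub_cancel _ _⟩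
  · simp
  · exact Subtype.ext (sub_right_injective hab)

/-- Replaces Schur's lemma: δ_L generates the source, and its image is an `L`-invariant vector,
determined by its value at 1. -/
theorem intertwiner_ext (h2 : (2 : F) ≠ 0) (hψ : ψ ≠ 1) {N L : Submodule F V}
    (hN : V.perp N = N) (hL : V.perp L = L) {T T' : model ψ L →ₗ[ℂ] model ψ N}
    (hT : ∀ g f, T (modelRep ψ L g f) = modelRep ψ N g (T f))
    (hT' : ∀ g f, T' (modelRep ψ L g f) = modelRep ψ N g (T' f))
    (h : (T (deltaModel ψ L hL.ge)).1 1 = (T' (deltaModel ψ L hL.ge)).1 1) : T = T' := by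
  have : Fintype V := Fintype.ofFinite V
  have hδ : T (deltaModel ψ L hL.ge) = T' (deltaModel ψ L hL.ge) := by
    rw [← sub_eq_zero]
    refine eq_zero_of_invariant ψ h2 hψ hN hL _ (fun l hl => ?_) (sub_eq_zero.mpr h)
    rw [map_sub, ← hT, ← hT', modelRep_deltaModel ψ _ hl]
  apply LinearMap.ext; intro f
  have hc : (Fintype.card L : ℂ) ≠ 0 := Nat.cast_ne_zero.mpr Fintype.card_ne_zero
  apply smul_right_injective _ hc
  change (Fintype.card L : ℂ) • T f = (Fintype.card L : ℂ) • T' f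
  rw [← map_smul, ← map_smul, model_eq_sum_deltaModel ψ hL.ge f, map_sum, map_sum]
  refine Finset.sum_congr rfl fun x _ => ?_
  rw [map_smul, map_smul, hT, hT', hδ]

theorem averaging_modelRep (M L : OLag V) (g : Heis V) (f : model ψ L.space) :
    averaging ψ M L (modelRep ψ L.space g f) = modelRep ψ M.space g (averaging ψ M L f) := by
  apply Subtype.ext; funext h
  refine Finset.sum_congr rfl fun m _ => ?_
  exact congrArg f.1 (mul_assoc _ _ _)

end Schur

/-! ### A Lagrangian transversal to three given ones -/

section Transversal

variable {F : Type u} [Field F]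

/-- If `x` avoids `A` and `B` but lies in `D`, take `y ∈ C` outside `D`. The points `y + t • x` all
avoid `D`, while `A` and `B` contain at most one of them each. The three parameters 0, 1, -1 are
distinct because 2 ≠ 0, so one of these points avoids everything. -/
theorem exists_notMem_three {E : Type v} [AddCommGroup E] [Module F E] (h2 : (2 : F) ≠ 0)
    {A B D C : Submodule F E} (hA : ¬ C ≤ A) (hB : ¬ C ≤ B) (hD : ¬ C ≤ D) :
    ∃ x ∈ C, x ∉ A ∧ x ∉ B ∧ x ∉ D := by
  obtain ⟨x, hxC, hxA, hxB⟩ := exists_notMem_of_ne_top hA hB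
  by_cases hxD : x ∉ D
  · exact ⟨x, hxC, hxA, hxB, hxD⟩
  rw [not_not] at hxD
  obtain ⟨y, hyC, hyD⟩ := SetLike.not_le_iff_exists.mp hD
  have key : ∀ Q : Submodule F E, x ∉ Q → ∀ s t : F, y + s • x ∈ Q → y + t • x ∈ Q → s = t := by
    intro Q hQ s t hs ht
    by_contra hst
    apply hQ
    have h := Q.smul_mem (s - t)⁻¹ (Q.sub_mem hs ht)
    rwa [add_sub_add_left_eq_sub, ← sub_smul, smul_smul,
      inv_mul_cancel₀ (sub_ne_zero.mpr hst), one_smul] at h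
  have hmem : ∀ t : F, y + t • x ∈ C := fun t => C.add_mem hyC (C.smul_mem _ hxC)
  have hnD : ∀ t : F, y + t • x ∉ D := fun t h =>
    hyD ((Submodule.add_mem_iff_left D (D.smul_mem t hxD)).mp h)
  have h01 : (0 : F) ≠ 1 := zero_ne_one
  have h0m : (0 : F) ≠ -1 := (neg_ne_zero.mpr one_ne_zero).symm
  have h1m : (1 : F) ≠ -1 := fun h => h2 (by linear_combination h)
  by_contra hcon
  push Not at hcon
  have hor : ∀ t : F, y + t • x ∈ A ∨ y + t • x ∈ B := by
    intro t
    by_contra hno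
    push Not at hno
    exact hnD t (hcon _ (hmem t) hno.1 hno.2)
  rcases hor 0 with h0 | h0 <;> rcases hor 1 with h1 | h1 <;> rcases hor (-1) with hm | hm
  · exact h01 (key A hxA _ _ h0 h1)
  · exact h01 (key A hxA _ _ h0 h1)
  · exact h0m (key A hxA _ _ h0 hm)
  · exact h1m (key B hxB _ _ h1 hm)
  · exact h1m (key A hxA _ _ h1 hm)
  · exact h0m (key B hxB _ _ h0 hm)
  · exact h01 (key B hxB _ _ h0 h1)
  · exact h01 (key B hxB _ _ h0 h1)

variable {V : SympSpace.{u, v} F}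

theorem inf_eq_bot_of_sup_span {S Q : Submodule F V} {x : V} (hQ : S ⊓ Q = ⊥)
    (hxQ : x ∉ S ⊔ Q) : (S ⊔ Submodule.span F {x}) ⊓ Q = ⊥ := by
  rw [eq_bot_iff]
  rintro y ⟨hy, hyQ⟩
  obtain ⟨s, hs, t, ht, rfl⟩ := Submodule.mem_sup.mp hy
  obtain ⟨c, rfl⟩ := Submodule.mem_span_singleton.mp ht
  by_cases hc : c = 0
  · subst hc
    rw [← hQ]
    rw [zero_smul, add_zero] at hyQ ⊢
    exact ⟨hs, hyQ⟩
  · exfalso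
    apply hxQ
    have : x = c⁻¹ • ((s + c • x) - s) := by
      rw [add_sub_cancel_left, smul_smul, inv_mul_cancel₀ hc, one_smul]
    rw [this]
    exact Submodule.smul_mem _ _ (Submodule.sub_mem _ (Submodule.mem_sup_right hyQ)
      (Submodule.mem_sup_left hs))

theorem sup_span_le_perp {S : Submodule F V} (hS : S ≤ V.perp S) {x : V} (hx : x ∈ V.perp S) :
    S ⊔ Submodule.span F {x} ≤ V.perp (S ⊔ Submodule.span F {x}) := by
  have h1 : Submodule.span F {x} ≤ V.perp S := by
    rw [Submodule.span_singleton_le_iff_mem]; exact hx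
  have h3 : S ≤ V.perp (Submodule.span F {x}) := by
    have := V.perp_anti h1
    rwa [V.perp_perp] at this
  have h4 : Submodule.span F {x} ≤ V.perp (Submodule.span F {x}) := by
    rw [Submodule.span_singleton_le_iff_mem]
    intro y hy
    obtain ⟨c, rfl⟩ := Submodule.mem_span_singleton.mp hy
    rw [map_smul, LinearMap.smul_apply, V.isAlt.self_eq_zero, smul_zero]
  rw [perp_sup]
  exact sup_le (le_inf hS h3) (le_inf h1 h4)

/-- Take `S` maximal among the isotropic subspaces that meet all three trivially. If it were not
Lagrangian, `perp_not_le` would give a vector of `S^⊥` outside `S + N`, `S + M` and `S + L`, and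
adjoining it would enlarge `S`. -/
theorem exists_common_transversal_three (h2 : (2 : F) ≠ 0) (N M L : Submodule F V)
    (hN : V.perp N = N) (hM : V.perp M = M) (hL : V.perp L = L) :
    ∃ S : Submodule F V, V.perp S = S ∧ S ⊓ N = ⊥ ∧ S ⊓ M = ⊥ ∧ S ⊓ L = ⊥ := by
  obtain ⟨S, ⟨hS, hSN, hSM, hSL⟩, hmax⟩ := WellFounded.has_min
    (wellFounded_gt (α := Submodule F V))
    {S | S ≤ V.perp S ∧ S ⊓ N = ⊥ ∧ S ⊓ M = ⊥ ∧ S ⊓ L = ⊥} ⟨⊥, by simp⟩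
  refine ⟨S, ?_, hSN, hSM, hSL⟩
  by_contra hne
  have hnle : ¬ V.perp S ≤ S := fun h => hne (le_antisymm h hS)
  obtain ⟨x, hx, hxN, hxM, hxL⟩ := exists_notMem_three h2
    (perp_not_le hS hnle hN) (perp_not_le hS hnle hM) (perp_not_le hS hnle hL)
  refine hmax (S ⊔ Submodule.span F {x}) ⟨sup_span_le_perp hS hx, inf_eq_bot_of_sup_span hSN hxN,
    inf_eq_bot_of_sup_span hSM hxM, inf_eq_bot_of_sup_span hSL hxL⟩ ?_
  apply lt_of_le_of_ne le_sup_left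
  intro h
  apply hxN
  apply Submodule.mem_sup_left
  rw [h]
  exact Submodule.mem_sup_right (Submodule.mem_span_singleton_self x)

theorem exists_lagrangian (V : SympSpace.{u, v} F) : ∃ S : Submodule F V, V.perp S = S := by
  obtain ⟨S, hS, hmax⟩ := WellFounded.has_min (wellFounded_gt (α := Submodule F V))
    {S | S ≤ V.perp S} ⟨⊥, (bot_le : ⊥ ≤ V.perp ⊥)⟩
  refine ⟨S, le_antisymm (fun x hx => ?_) hS⟩
  by_contra hxS
  refine hmax (S ⊔ Submodule.span F {x}) (sup_span_le_perp hS hx) (lt_of_le_of_ne le_sup_left ?_)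
  intro h
  apply hxS
  rw [h]
  exact Submodule.mem_sup_right (Submodule.mem_span_singleton_self x)

theorem exists_oLag {S : Submodule F V} (hS : V.perp S = S) : ∃ L : OLag V, L.space = S := by
  obtain ⟨x, hx, hx0⟩ := topPower_exists S
  exact ⟨⟨⟨S, x, hx, hx0⟩, hS⟩, rfl⟩

theorem OLag.exists_generalPosition_three (h2 : (2 : F) ≠ 0) (N M L : OLag V) :
    ∃ S : OLag V, S.space ⊓ N.space = ⊥ ∧ S.space ⊓ M.space = ⊥ ∧ S.space ⊓ L.space = ⊥ := by
  obtain ⟨S, hS, h⟩ := exists_common_transversal_three h2 N.space M.space L.space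
    N.lagrangian M.lagrangian L.lagrangian
  obtain ⟨S, rfl⟩ := exists_oLag hS
  exact ⟨S, h⟩

end Transversal

/-! ### Orientations and normalization constants in bases -/

section Orientation

variable {F : Type u} [Field F]

/-- The family `l` is a basis of the subspace `L`. -/
structure IsBasisOf {E : Type v} [AddCommGroup E] [Module F E] {ι : Type*} (l : ι → E)
    (L : Submodule F E) : Prop where
  linearIndependent : LinearIndependent F l
  span_eq : Submodule.span F (Set.range l) = L

namespace IsBasisOf

variable {E : Type v} [AddCommGroup E] [Module F E] {ι κ : Type*} {l : ι → E} {L : Submodule F E}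

theorem mem (h : IsBasisOf l L) (i : ι) : l i ∈ L := by
  rw [← h.span_eq]
  exact Submodule.subset_span ⟨i, rfl⟩

/-- The basis of `L` given by `l`. -/
def basis (h : IsBasisOf l L) : Module.Basis ι F L :=
  (Module.Basis.span h.linearIndependent).map (LinearEquiv.ofEq _ _ h.span_eq)

@[simp] theorem coe_basis (h : IsBasisOf l L) (i : ι) : (h.basis i : E) = l i := by
  simp [basis, Module.Basis.span_apply]

theorem comp_equiv (h : IsBasisOf l L) (e : κ ≃ ι) : IsBasisOf (l ∘ e) L where
  linearIndependent := h.linearIndependent.comp _ e.injective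
  span_eq := by rw [EquivLike.range_comp, h.span_eq]

theorem of_basis (b : Module.Basis ι F L) : IsBasisOf (fun i => (b i : E)) L where
  linearIndependent := b.linearIndependent.map' L.subtype L.ker_subtype
  span_eq := by
    have := congrArg (Submodule.map L.subtype) b.span_eq
    rw [Submodule.map_span, Submodule.map_subtype_top, ← Set.range_comp] at this
    exact this

theorem finrank_eq {d : ℕ} {l : Fin d → E} (h : IsBasisOf l L) : Module.finrank F L = d := by
  rw [Module.finrank_eq_card_basis h.basis, Fintype.card_fin]

theorem ιMulti_mem {d : ℕ} {l : Fin d → E} (h : IsBasisOf l L) :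
    ExteriorAlgebra.ιMulti F d l ∈ topPower L := by
  refine ⟨ExteriorAlgebra.ιMulti F d h.basis, ?_, ?_⟩
  · rw [h.finrank_eq]
    exact ExteriorAlgebra.ιMulti_range F d ⟨_, rfl⟩
  · change ExteriorAlgebra.map L.subtype _ = _
    rw [ExteriorAlgebra.map_apply_ιMulti]
    congr 1
    funext i
    exact h.coe_basis i

/-- The determinant with respect to `b`, viewed as a functional on the exterior power, takes the
value 1 on this element. -/
theorem ιMulti_basis_ne_zero {d : ℕ} {M : Type v} [AddCommGroup M] [Module F M]
    (b : Module.Basis (Fin d) F M) : exteriorPower.ιMulti F d b ≠ 0 := by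
  intro h0
  have h1 := exteriorPower.alternatingMapLinearEquiv_apply_ιMulti b.det b
  rw [h0, map_zero, b.det_self] at h1
  exact zero_ne_one h1

theorem exists_eq_smul_ιMulti {d : ℕ} {l : Fin d → E} (h : IsBasisOf l L)
    {x : ExteriorAlgebra F E} (hx : x ∈ topPower L) :
    ∃ a : F, x = a • ExteriorAlgebra.ιMulti F d l := by
  obtain ⟨y, hy, rfl⟩ := hx
  have hd := h.finrank_eq
  subst hd
  have : Module.Finite F L := Module.Finite.of_basis h.basis
  have h1 : Module.finrank F (⋀[F]^(Module.finrank F L) L) = 1 := by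
    rw [exteriorPower.finrank_eq, Nat.choose_self]
  obtain ⟨a, ha⟩ := (finrank_eq_one_iff_of_nonzero' _ (ιMulti_basis_ne_zero h.basis)).mp h1 ⟨y, hy⟩
  refine ⟨a, ?_⟩
  have ha' : y = a • ExteriorAlgebra.ιMulti F _ h.basis := (congrArg Subtype.val ha).symm
  rw [ha']
  change ExteriorAlgebra.map L.subtype _ = _
  rw [map_smul, ExteriorAlgebra.map_apply_ιMulti]
  congr 2
  funext i
  exact h.coe_basis i

theorem ιMulti_ne_zero {d : ℕ} {l : Fin d → E} (h : IsBasisOf l L) :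
    ExteriorAlgebra.ιMulti F d l ≠ 0 := by
  have : Module.Finite F L := Module.Finite.of_basis h.basis
  have h1 := ιMulti_basis_ne_zero h.basis
  intro h0
  apply h1
  apply exteriorPower.map_injective_field (n := d) (f := L.subtype) (by simp)
  rw [map_zero, exteriorPower.map_apply_ιMulti]
  apply Subtype.ext
  rw [ZeroMemClass.coe_zero, ← h0, exteriorPower.ιMulti_apply_coe]
  congr 1
  funext i
  exact h.coe_basis i

theorem exists_extend [Module.Finite F E] {I : Submodule F E} {i : ι → E} (h : IsBasisOf i I)
    (hIL : I ≤ L) : ∃ (r : ℕ) (k : Fin r → E), IsBasisOf (Sum.elim i k) L := by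
  obtain ⟨C, hC⟩ := Submodule.exists_isCompl I
  let b := Module.finBasis F (C ⊓ L : Submodule F E)
  have hb := of_basis b
  refine ⟨_, fun j => (b j : E), ?_, ?_⟩
  · refine h.linearIndependent.sum_type hb.linearIndependent ?_
    rw [h.span_eq, hb.span_eq]
    exact hC.disjoint.mono_right inf_le_left
  -- By the modular law, `C ⊓ L` is a complement of `I` inside `L`.
  · rw [Set.Sum.elim_range, Submodule.span_union, h.span_eq, hb.span_eq, sup_inf_assoc_of_le _ hIL |>.symm,
      hC.sup_eq_top, top_inf_eq]

end IsBasisOf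

variable {V : SympSpace.{u, v} F}

theorem omegaWedge_smul_smul (n : ℕ) (a b : F) (x y : ⋀[F]^n V) :
    omegaWedge V n (a • x) (b • y) = a * b * omegaWedge V n x y := by
  unfold omegaWedge
  simp only [map_smul, LinearMap.smul_apply, smul_eq_mul]
  ring

/-- The explicit sign cancels the one built into `omegaWedge`. Leaving `d` free allows it to be a
sum such as `i + r`. -/
theorem omegaWedge_vecPower {d : ℕ} (hd : d = V.halfDim) {L M : OLag V} {a b : F}
    {l m : Fin d → V} (hL : L.vec = a • ExteriorAlgebra.ιMulti F d l)
    (hM : M.vec = b • ExteriorAlgebra.ιMulti F d m) :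
    (-1) ^ (V.halfDim.choose 2) * omegaWedge V V.halfDim L.vecPower M.vecPower =
      a * b * (Matrix.of fun i j => V.form (l i) (m j)).det := by
  subst hd
  have h1 : L.vecPower = a • exteriorPower.ιMulti F V.halfDim l := Subtype.ext hL
  have h2 : M.vecPower = b • exteriorPower.ιMulti F V.halfDim m := Subtype.ext hM
  have h3 : ((-1 : F) ^ (V.halfDim.choose 2)) * (-1) ^ (V.halfDim.choose 2) = 1 := by
    rw [← mul_pow]; simp
  rw [h1, h2, omegaWedge_smul_smul, omegaWedge_ιMulti]
  linear_combination a * b * (Matrix.of fun i j => V.form (l i) (m j)).det * h3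

/-- `l` is a basis of the oriented subspace `L`, with orientation `a` times the
exterior product of `l`. -/
structure IsOrientedBasis {d : ℕ} (L : OSubspace V) (l : Fin d → V) (a : F) : Prop extends
    IsBasisOf l L.space where
  vec_eq : L.vec = a • ExteriorAlgebra.ιMulti F d l

theorem IsOrientedBasis.ne_zero {d : ℕ} {L : OSubspace V} {l : Fin d → V} {a : F}
    (h : IsOrientedBasis L l a) : a ≠ 0 := by
  rintro rfl
  exact L.vec_ne (by rw [h.vec_eq, zero_smul])

theorem IsBasisOf.exists_isOrientedBasis {d : ℕ} {L : OSubspace V} {l : Fin d → V}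
    (h : IsBasisOf l L.space) : ∃ a, IsOrientedBasis L l a := by
  obtain ⟨a, ha⟩ := h.exists_eq_smul_ιMulti L.vec_mem
  exact ⟨a, h, ha⟩

theorem IsOrientedBasis.eq_halfDim {d : ℕ} {L : OLag V} {l : Fin d → V} {a : F}
    (h : IsOrientedBasis L.toOSubspace l a) : d = V.halfDim := by
  rw [← L.finrank_eq]
  exact h.finrank_eq.symm

/-- The index type `ι` keeps the block structure of adapted bases visible in the matrix; the
enumeration `e` only serves to order the exterior products. -/
theorem normConst_eq [Fintype F] [DecidableEq F] (ψ : AddChar F ℂ) {ι : Type*} [Fintype ι]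
    [DecidableEq ι] {d : ℕ} (e : Fin d ≃ ι) {L M : OLag V} {a b : F} {l m : ι → V}
    (hL : IsOrientedBasis L.toOSubspace (l ∘ e) a) (hM : IsOrientedBasis M.toOSubspace (m ∘ e) b) :
    normConst ψ M L = (gaussSumOne ψ / (Fintype.card F : ℂ)) ^ d *
      quadraticChar F (a * b * (Matrix.of fun i j => V.form (l i) (m j)).det) := by
  unfold normConst
  rw [omegaWedge_vecPower hL.eq_halfDim hL.vec_eq hM.vec_eq,
    ← Matrix.det_submatrix_equiv_self e (Matrix.of fun i j => V.form (l i) (m j))]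
  congr 2
  exact hL.eq_halfDim.symm

end Orientation

/-! ### Projection to a Lagrangian along a transversal one -/

section Transversal

variable {F : Type u} [Field F] {V : SympSpace.{u, v} F}

theorem exists_projection {L S : Submodule F V} (hL : V.perp L = L) (hS : V.perp S = S)
    (h : S ⊓ L = ⊥) :
    ∃ p : V →ₗ[F] V, (∀ x, p x ∈ L) ∧ (∀ x, p x - x ∈ S) ∧ ∀ x ∈ L, p x = x := by
  have hc : IsCompl L S := ⟨disjoint_iff.mpr (by rw [inf_comm, h]),
    codisjoint_iff.mpr (by rw [sup_comm, sup_eq_top_of_inf hS hL h])⟩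
  refine ⟨L.subtype ∘ₗ L.projectionOnto S hc, fun x => (L.projectionOnto S hc x).2,
    fun x => ?_, fun x hx => ?_⟩
  · have : L.subtype (L.projectionOnto S hc x) - x ∈ LinearMap.ker (L.projectionOnto S hc) := by
      rw [LinearMap.mem_ker, map_sub, sub_eq_zero]
      exact Submodule.projectionOnto_apply_left hc _
    rwa [Submodule.ker_projectionOnto hc] at this
  · exact congrArg Subtype.val (Submodule.projectionOnto_apply_left hc ⟨x, hx⟩)

/-- A kernel vector of the matrix would give a vector of `S` orthogonal to `L`, hence in `S ∩ L =
0`. -/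
theorem det_form_ne_zero {ι : Type*} [Fintype ι] [DecidableEq ι] {L S : Submodule F V} {l s : ι → V}
    (hL : V.perp L = L) (h : S ⊓ L = ⊥) (hl : IsBasisOf l L) (hs : IsBasisOf s S) :
    (Matrix.of fun i j => V.form (l i) (s j)).det ≠ 0 := by
  intro h0
  obtain ⟨x, hx0, hx⟩ := Matrix.exists_mulVec_eq_zero_iff.mpr h0
  apply hx0
  have hmem : ∑ j, x j • s j ∈ S ⊓ L := by
    refine ⟨Submodule.sum_mem _ fun j _ => S.smul_mem _ (hs.mem j), ?_⟩
    rw [← hL, ← hl.span_eq]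
    intro y hy
    induction hy using Submodule.span_induction with
    | mem y hy =>
      obtain ⟨i, rfl⟩ := hy
      have := congrFun hx i
      simpa [Matrix.mulVec, dotProduct, mul_comm] using this
    | zero => simp
    | add y z _ _ h1 h2 => rw [map_add, LinearMap.add_apply, h1, h2, add_zero]
    | smul c y _ h1 => rw [map_smul, LinearMap.smul_apply, h1, smul_zero]
  rw [h, Submodule.mem_bot] at hmem
  funext j
  exact Fintype.linearIndependent_iff.mp hs.linearIndependent x hmem j

/-- Expand ω(px - x, py - y) = 0, which holds as `S` is isotropic. The terms ω(px, py) and ω(x, y)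
vanish because `L` and `N` are isotropic. -/
theorem form_projection_symm {L S N : Submodule F V} (hL : V.perp L = L) (hS : V.perp S = S)
    (hN : V.perp N = N) {p : V →ₗ[F] V} (hpL : ∀ x, p x ∈ L) (hpS : ∀ x, p x - x ∈ S)
    {x y : V} (hx : x ∈ N) (hy : y ∈ N) : V.form (p x) y = V.form (p y) x := by
  have e1 : V.form (p x) (p y) = 0 := hL.ge (hpL y) _ (hpL x)
  have e2 : V.form x y = 0 := hN.ge hy _ hx
  have e3 : V.form (p x - x) (p y - y) = 0 := hS.ge (hpS y) _ (hpS x)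
  simp only [map_sub, LinearMap.sub_apply, e1, e2] at e3
  rw [V.form_swap (p y) x]
  linear_combination -e3

variable {i r : ℕ} {bI : Fin i → V} {k m : Fin r → V}

/-- A kernel vector gives `w` in the span of `m` with `p w` orthogonal to all of `N`, so `p w ∈ N`.
Then `p w - w` lies in `S ∩ N = 0`, hence `w ∈ L ∩ N`, which meets the span of `m` trivially. -/
theorem det_projection_ne_zero {L S N : Submodule F V} (hL : V.perp L = L) (hS : V.perp S = S)
    (hN : V.perp N = N) (hSN : S ⊓ N = ⊥)
    (hI : IsBasisOf bI (L ⊓ N)) (hm : IsBasisOf (Sum.elim bI m) N)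
    {p : V →ₗ[F] V} (hpL : ∀ x, p x ∈ L) (hpS : ∀ x, p x - x ∈ S) :
    (Matrix.of fun a b => V.form (p (m a)) (m b)).det ≠ 0 := by
  intro h0
  obtain ⟨x, hx0, hx⟩ := Matrix.exists_mulVec_eq_zero_iff.mpr h0
  apply hx0
  set w := ∑ j, x j • m j with hw
  have hmN : ∀ j, m j ∈ N := fun j => hm.mem (Sum.inr j)
  have hwN : w ∈ N := Submodule.sum_mem _ fun j _ => N.smul_mem _ (hmN j)
  have h1 : p w ∈ N := by
    rw [← hN, ← hm.span_eq]
    intro y hy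
    induction hy using Submodule.span_induction with
    | mem y hy =>
      obtain ⟨a | a, rfl⟩ := hy
      · exact hL.ge (hpL w) _ (hI.mem a).1
      · change V.form (m a) (p w) = 0
        rw [V.form_swap, form_projection_symm hL hS hN hpL hpS hwN (hmN a), neg_eq_zero, hw]
        have := congrFun hx a
        simpa [Matrix.mulVec, dotProduct, mul_comm] using this
    | zero => simp
    | add y z _ _ h1 h2 => rw [map_add, LinearMap.add_apply, h1, h2, add_zero]
    | smul c y _ h1 => rw [map_smul, LinearMap.smul_apply, h1, smul_zero]
  have h2 : p w - w ∈ S ⊓ N := ⟨hpS w, N.sub_mem h1 hwN⟩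
  rw [hSN, Submodule.mem_bot, sub_eq_zero] at h2
  have h3 : w ∈ Submodule.span F (Set.range bI) := by
    rw [hI.span_eq]
    exact ⟨h2 ▸ hpL w, hwN⟩
  have hli := linearIndependent_sum.mp hm.linearIndependent
  have h4 : w ∈ Submodule.span F (Set.range m) :=
    Submodule.sum_mem _ fun j _ => Submodule.smul_mem _ _ (Submodule.subset_span ⟨j, rfl⟩)
  have h5 : w = 0 := Submodule.disjoint_def.mp hli.2.2 w h3 h4
  funext j
  exact Fintype.linearIndependent_iff.mp hli.2.1 x h5 j

/-- `P` holds the `k`-coordinates of the vectors `p (m b)`. As `p n - n ∈ S`, pairing with `S` does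
not distinguish `n` from `p n`, so the pairing of `S` with `N` is that of `S` with `L` times a block
triangular matrix with diagonal blocks 1 and `P`. The sign comes from exchanging the arguments of ω.
Against `N` the `bI`-coordinates drop out, which gives the second identity. -/
theorem det_pairing_projection {L S N : Submodule F V} (hS : V.perp S = S) (hN : V.perp N = N)
    {s : Fin i ⊕ Fin r → V} (hI : IsBasisOf bI (L ⊓ N)) (hk : IsBasisOf (Sum.elim bI k) L)
    (hm : IsBasisOf (Sum.elim bI m) N) (hs : IsBasisOf s S)
    {p : V →ₗ[F] V} (hpL : ∀ x, p x ∈ L) (hpS : ∀ x, p x - x ∈ S) :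
    ∃ P : Matrix (Fin r) (Fin r) F,
      (Matrix.of fun a b => V.form (s a) (Sum.elim bI m b)).det = (-1) ^ (i + r) *
        (Matrix.of fun a b => V.form (Sum.elim bI k a) (s b)).det * P.det ∧
      (Matrix.of fun a b => V.form (p (m a)) (m b)).det =
        P.det * (Matrix.of fun a b => V.form (k a) (m b)).det := by
  let c : Fin r → Fin i ⊕ Fin r → F := fun b => hk.basis.repr ⟨p (m b), hpL _⟩
  have hc : ∀ b, p (m b) = ∑ a, c b (Sum.inl a) • bI a + ∑ a, c b (Sum.inr a) • k a := by
    intro b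
    have h := hk.basis.sum_repr ⟨p (m b), hpL _⟩
    rw [Fintype.sum_sum_type] at h
    simpa [c] using (congrArg Subtype.val h).symm
  let P : Matrix (Fin r) (Fin r) F := Matrix.of fun a b => c b (Sum.inr a)
  let Q : Matrix (Fin i) (Fin r) F := Matrix.of fun a b => c b (Sum.inl a)
  refine ⟨P, ?_, ?_⟩
  · have h1 : (Matrix.of fun a b => V.form (s a) (Sum.elim bI m b)) =
        -((Matrix.of fun a b => V.form (Sum.elim bI k a) (s b)).transpose *
          Matrix.fromBlocks 1 Q 0 P) := by
      ext a (b | b)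
      · simp only [Matrix.mul_apply, Matrix.neg_apply, Fintype.sum_sum_type, Matrix.of_apply,
          Matrix.transpose_apply, Sum.elim_inl, Matrix.fromBlocks_apply₁₁,
          Matrix.fromBlocks_apply₂₁, Matrix.zero_apply, mul_zero, Finset.sum_const_zero, add_zero,
          Matrix.one_apply, mul_ite, mul_one, Finset.sum_ite_eq',
          Finset.mem_univ, if_true]
        exact V.form_swap _ _
      · have e1 : V.form (s a) (m b) = V.form (s a) (p (m b)) := by
          have := hS.ge (hpS (m b)) _ (hs.mem a)
          rw [map_sub, sub_eq_zero] at this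
          exact this.symm
        simp only [Matrix.mul_apply, Matrix.neg_apply, Fintype.sum_sum_type, Matrix.of_apply,
          Matrix.transpose_apply, Sum.elim_inl, Sum.elim_inr, Matrix.fromBlocks_apply₁₂,
          Matrix.fromBlocks_apply₂₂, P, Q]
        rw [e1, hc]
        simp only [map_add, map_sum, map_smul, smul_eq_mul, neg_add, ← Finset.sum_neg_distrib]
        congr 1 <;>
        · refine Finset.sum_congr rfl fun j _ => ?_
          rw [V.form_swap (s a)]
          ring
    rw [h1, Matrix.det_neg, Matrix.det_mul, Matrix.det_transpose, Matrix.det_fromBlocks_zero₂₁,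
      Matrix.det_one, one_mul, Fintype.card_sum, Fintype.card_fin, Fintype.card_fin, mul_assoc]
  · rw [← Matrix.det_transpose P, ← Matrix.det_mul]
    congr 1
    ext a b
    have h0 : ∀ j, V.form (bI j) (m b) = 0 := fun j =>
      hN.ge (hm.mem (Sum.inr b)) _ (hI.mem j).2
    simp only [Matrix.of_apply, Matrix.mul_apply, Matrix.transpose_apply, P]
    rw [hc]
    simp [h0]

end Transversal

/-! ### The composite of two averaging maps, evaluated on δ_L -/

section Value

variable {F : Type u} [Field F] [Fintype F] (ψ : AddChar F ℂ) {V : SympSpace.{u, v} F}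

/-- For fixed `n`, only `s = p n - n` brings `s + n` into `L`. The central coordinate of the product
is then ½ω(pn - n, n) = ½ω(pn, n). -/
theorem averaging_averaging_delta {L S N : OLag V} (h : S.space ⊓ L.space = ⊥)
    {p : V →ₗ[F] V} (hpL : ∀ x, p x ∈ L.space) (hpS : ∀ x, p x - x ∈ S.space) :
    (averaging ψ N S (averaging ψ S L (deltaModel ψ L.space L.lagrangian.ge))).1 1 =
      ∑ n : N.space, ψ (2⁻¹ * V.form (p n) n) := by
  refine Finset.sum_congr rfl fun n _ => ?_
  change ∑ s : S.space, (deltaModel ψ L.space L.lagrangian.ge).1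
    (Heis.ofVec (s : V) * (Heis.ofVec (n : V) * 1)) = _
  rw [mul_one, Finset.sum_eq_single ⟨p n - n, hpS n⟩]
  · have hv : (Heis.ofVec (p n - n : V) * Heis.ofVec (n : V)).vec = p n := sub_add_cancel _ _
    rw [deltaModel_of_mem ψ _ (by rw [hv]; exact hpL n)]
    congr 1
    simp [Heis.mul_def, Heis.ofVec, V.isAlt.self_eq_zero]
  · intro s _ hs
    apply deltaModel_of_notMem
    intro hmem
    apply hs
    have h1 : (s : V) + n - p n ∈ L.space := L.space.sub_mem hmem (hpL n)
    have h2 : (s : V) + n - p n ∈ S.space := by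
      have := S.space.sub_mem s.2 (hpS n)
      rwa [sub_sub_eq_add_sub] at this
    have h3 : (s : V) + n - p n ∈ S.space ⊓ L.space := ⟨h2, h1⟩
    rw [h, Submodule.mem_bot] at h3
    apply Subtype.ext
    change (s : V) = p n - n
    rw [eq_sub_iff_add_eq]
    exact sub_eq_zero.mp h3
  · intro h; exact absurd (Finset.mem_univ _) h

variable {i r : ℕ} {bI : Fin i → V} {k m : Fin r → V}

variable [DecidableEq F]

/-- The subspace `L ∩ N` is contained in the radical of the quadratic form ω(pn, n) and contributes
the factor q^i. On the span of `m` the form is nondegenerate. -/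
theorem sum_addChar_projection (hF : ringChar F ≠ 2) (hψ : ψ ≠ 1) {L S N : Submodule F V}
    (hL : V.perp L = L) (hS : V.perp S = S)
    (hN : V.perp N = N) (hSN : S ⊓ N = ⊥)
    (hI : IsBasisOf bI (L ⊓ N)) (hm : IsBasisOf (Sum.elim bI m) N)
    {p : V →ₗ[F] V} (hpL : ∀ x, p x ∈ L) (hpS : ∀ x, p x - x ∈ S) (hpx : ∀ x ∈ L, p x = x) :
    ∑ n : N, ψ (2⁻¹ * V.form (p n) n) = (Fintype.card F : ℂ) ^ i * (gaussSumOne ψ ^ r *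
      quadraticChar F (Matrix.of fun a b => V.form (p (m a)) (m b)).det) := by
  have hmN : ∀ j, m j ∈ N := fun j => hm.mem (Sum.inr j)
  rw [← sum_addChar_half_quadratic hF hψ _ ?_
    (det_projection_ne_zero hL hS hN hSN hI hm hpL hpS)]
  swap
  · ext a b
    exact form_projection_symm hL hS hN hpL hpS (hmN b) (hmN a)
  let e := (Equiv.sumArrowEquivProdArrow (Fin i) (Fin r) F).symm.trans hm.basis.equivFun.symm.toEquiv
  rw [← Equiv.sum_comp e, Fintype.sum_prod_type]
  have key : ∀ (y : Fin i → F) (z : Fin r → F), V.form (p (e (y, z) : V)) (e (y, z) : V) =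
      z ⬝ᵥ (Matrix.of fun a b => V.form (p (m a)) (m b)).mulVec z := by
    intro y z
    have he : (e (y, z) : V) = ∑ a, y a • bI a + ∑ a, z a • m a := by
      simp [e, Module.Basis.equivFun_symm_apply]
    have hu : ∑ a, y a • bI a ∈ L ⊓ N :=
      Submodule.sum_mem _ fun j _ => Submodule.smul_mem _ _ (hI.mem j)
    have hw : ∑ a, z a • m a ∈ N := Submodule.sum_mem _ fun j _ => N.smul_mem _ (hmN j)
    have e1 : V.form (∑ a, y a • bI a) (∑ a, y a • bI a) = 0 := V.isAlt.self_eq_zero _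
    have e2 : V.form (∑ a, y a • bI a) (∑ a, z a • m a) = 0 := hN.ge hw _ hu.2
    have e3 : V.form (p (∑ a, z a • m a)) (∑ a, y a • bI a) = 0 := hL.ge hu.1 _ (hpL _)
    rw [he, map_add p, hpx _ hu.1, map_add V.form, LinearMap.add_apply, map_add, e1, e2, map_add, e3]
    simp only [zero_add, map_sum, map_smul, LinearMap.sum_apply, LinearMap.smul_apply, smul_eq_mul,
      Matrix.mulVec, dotProduct, Matrix.of_apply, Finset.mul_sum]
    rw [Finset.sum_comm]
    refine Finset.sum_congr rfl fun a _ => Finset.sum_congr rfl fun b _ => ?_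
    ring
  simp only [key, Finset.sum_const, Finset.card_univ, nsmul_eq_mul, Fintype.card_fun,
    Fintype.card_fin, Nat.cast_pow]

/-- The decisive point is that `S` is absent from the right-hand side. Its orientation `c`, its
pairing `X` with `L` and the determinant of `P` each occur under σ twice. -/
theorem ansatz_comp_delta (hF : ringChar F ≠ 2) (hψ : ψ ≠ 1) {L S N : OLag V}
    (hSL : S.space ⊓ L.space = ⊥) (hSN : S.space ⊓ N.space = ⊥) {a b : F}
    (hI : IsBasisOf bI (L.space ⊓ N.space))
    (hk : IsOrientedBasis L.toOSubspace (Sum.elim bI k ∘ finSumFinEquiv.symm) a)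
    (hm : IsOrientedBasis N.toOSubspace (Sum.elim bI m ∘ finSumFinEquiv.symm) b) :
    ((normConst ψ N S • averaging ψ N S) ((normConst ψ S L • averaging ψ S L)
      (deltaModel ψ L.space L.lagrangian.ge))).1 1 =
    (gaussSumOne ψ / (Fintype.card F : ℂ)) ^ r *
      quadraticChar F (a * b * (Matrix.of fun a b => V.form (k a) (m b)).det) := by
  have hk' : IsBasisOf (Sum.elim bI k) L.space := by
    simpa [Function.comp_assoc] using hk.toIsBasisOf.comp_equiv finSumFinEquiv
  have hm' : IsBasisOf (Sum.elim bI m) N.space := by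
    simpa [Function.comp_assoc] using hm.toIsBasisOf.comp_equiv finSumFinEquiv
  have hd : Module.finrank F S.space = i + r := by rw [S.finrank_eq, hk.eq_halfDim]
  let s : Fin i ⊕ Fin r → V :=
    fun j => ((Module.finBasisOfFinrankEq F S.space hd).reindex finSumFinEquiv.symm j : V)
  have hs : IsBasisOf s S.space := IsBasisOf.of_basis _
  obtain ⟨c, hc⟩ := (hs.comp_equiv finSumFinEquiv.symm).exists_isOrientedBasis
    (L := S.toOSubspace)
  obtain ⟨p, hpL, hpS, hpx⟩ := exists_projection L.lagrangian S.lagrangian hSL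
  obtain ⟨P, hP1, hP2⟩ := det_pairing_projection S.lagrangian N.lagrangian hI hk' hm' hs hpL hpS
  have hX := det_form_ne_zero L.lagrangian hSL hk' hs
  have hA := det_projection_ne_zero L.lagrangian S.lagrangian N.lagrangian hSN hI hm' hpL hpS
  have hval := averaging_averaging_delta ψ (N := N) hSL hpL hpS
  rw [sum_addChar_projection ψ hF hψ L.lagrangian S.lagrangian N.lagrangian hSN hI hm' hpL hpS hpx]
    at hval
  rw [LinearMap.smul_apply, LinearMap.smul_apply, map_smul]
  change normConst ψ N S * (normConst ψ S L * _) = _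
  rw [hval, normConst_eq ψ finSumFinEquiv.symm hk hc, normConst_eq ψ finSumFinEquiv.symm hc hm, hP1,
    hP2]
  rw [hP2] at hA
  have hP0 := left_ne_zero_of_mul hA
  set X := (Matrix.of fun a b => V.form (Sum.elim bI k a) (s b)).det
  set W := (Matrix.of fun a b => V.form (k a) (m b)).det
  have hG := gaussSumOne_sq hF hψ
  have sq1 : ∀ {x : F}, x ≠ 0 → ((quadraticChar F x : ℤ) : ℂ) ^ 2 = 1 := fun hx => by
    exact_mod_cast quadraticChar_sq_one hx
  have hε := sq1 (neg_ne_zero.mpr (one_ne_zero (α := F)))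
  have hX2 := sq1 hX
  have hP2 := sq1 hP0
  have hc2 := sq1 hc.ne_zero
  have hq : (Fintype.card F : ℂ) ≠ 0 := Nat.cast_ne_zero.mpr Fintype.card_ne_zero
  simp only [map_mul, map_pow, Int.cast_mul, Int.cast_pow]
  set ε : ℂ := ((quadraticChar F (-1) : ℤ) : ℂ)
  set q : ℂ := (Fintype.card F : ℂ)
  set G := gaussSumOne ψ
  -- Since G² = εq and ε² = 1, each factor (G/q)²ε is 1/q. Of the resulting q^{-(i+r)}, the radical
  -- cancels q^i, and G^r remains over q^r.
  have hmain : (G / q) ^ (i + r) * (G / q) ^ (i + r) * q ^ i * G ^ r * ε ^ (i + r) =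
      (G / q) ^ r := by
    have e1 : (G / q) ^ (i + r) * (G / q) ^ (i + r) * ε ^ (i + r) = q⁻¹ ^ (i + r) := by
      rw [← mul_pow, ← mul_pow]
      congr 1
      field_simp
      rw [hG]
      linear_combination q * hε
    calc _ = ((G / q) ^ (i + r) * (G / q) ^ (i + r) * ε ^ (i + r)) * (q ^ i * G ^ r) := by ring
      _ = _ := by
        rw [e1, pow_add, inv_pow, inv_pow, div_pow]
        field_simp
  rw [← hmain]
  -- The factor σ(c)²σ(X)²σ(det P)² is reduced to 1 one square at a time.
  linear_combination ((G / q) ^ (i + r) * (G / q) ^ (i + r) * q ^ i * G ^ r * ε ^ (i + r) *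
    (quadraticChar F a : ℤ) * (quadraticChar F b : ℤ) * (quadraticChar F W : ℤ)) * (
      (quadraticChar F X : ℤ) ^ 2 * (quadraticChar F P.det : ℤ) ^ 2 * hc2 +
      (quadraticChar F X : ℤ) ^ 2 * hP2 + hX2)

end Value

/-! ### Existence of the canonical trivialization -/

section Existence

variable {F : Type u} [Field F] {V : SympSpace.{u, v} F}

theorem OLag.exists_adapted_bases (L N : OLag V) :
    ∃ (i r : ℕ) (bI : Fin i → V) (k m : Fin r → V) (a b : F),
      IsBasisOf bI (L.space ⊓ N.space) ∧
      IsOrientedBasis L.toOSubspace (Sum.elim bI k ∘ finSumFinEquiv.symm) a ∧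
      IsOrientedBasis N.toOSubspace (Sum.elim bI m ∘ finSumFinEquiv.symm) b := by
  have hI : IsBasisOf (fun j => (Module.finBasis F (L.space ⊓ N.space : Submodule F V) j : V))
    (L.space ⊓ N.space) := IsBasisOf.of_basis _
  obtain ⟨r, k, hk⟩ := hI.exists_extend inf_le_left
  obtain ⟨r', m, hm⟩ := hI.exists_extend inf_le_right
  obtain ⟨a, ha⟩ := (hk.comp_equiv finSumFinEquiv.symm).exists_isOrientedBasis (L := L.toOSubspace)
  obtain ⟨b, hb⟩ := (hm.comp_equiv finSumFinEquiv.symm).exists_isOrientedBasis (L := N.toOSubspace)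
  obtain rfl : r = r' := by
    have := ha.eq_halfDim.trans hb.eq_halfDim.symm
    omega
  exact ⟨_, r, _, k, m, a, b, hI, ha, hb⟩

theorem generalPosition_iff {M L : OLag V} :
    GeneralPosition M L ↔ M.space ⊓ L.space = ⊥ := by
  constructor
  · intro h
    rw [← M.lagrangian, ← L.lagrangian, ← perp_sup, show M.space ⊔ L.space = ⊤ from h, eq_bot_iff]
    intro x hx
    rw [Submodule.mem_bot]
    exact V.nondegenerate.2 x fun y => hx y trivial
  · exact sup_eq_top_of_inf M.lagrangian L.lagrangian

variable (ψ : AddChar F ℂ)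

theorem deltaModel_apply_one {L : Submodule F V} (hL : L ≤ V.perp L) :
    (deltaModel ψ L hL).1 1 = 1 := by
  rw [deltaModel_of_mem ψ hL (h := 1) L.zero_mem]
  exact AddChar.map_zero_eq_one ψ

theorem isTrivialization_of_mul {T : System ψ V}
    (hint : ∀ (M L : OLag V) (g : Heis V) (f : model ψ L.space),
      T M L (modelRep ψ L.space g f) = modelRep ψ M.space g (T M L f))
    (hmul : ∀ N M L : OLag V, T N M ∘ₗ T M L = T N L) (hone : ∀ L, T L L = LinearMap.id) :
    IsTrivialization ψ T where
  intertwining := hint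
  mul := hmul
  bijective M L := Function.bijective_iff_has_inverse.mpr ⟨T L M,
    fun f => by rw [← LinearMap.comp_apply, hmul, hone]; rfl,
    fun f => by rw [← LinearMap.comp_apply, hmul, hone]; rfl⟩

variable [Fintype F] [DecidableEq F]

/-- The explicit formula for the canonical intertwining morphisms in general position. -/
def ansatz (M L : OLag V) : model ψ L.space →ₗ[ℂ] model ψ M.space :=
  normConst ψ M L • averaging ψ M L

theorem ansatz_modelRep (M L : OLag V) (g : Heis V) (f : model ψ L.space) :
    ansatz ψ M L (modelRep ψ L.space g f) = modelRep ψ M.space g (ansatz ψ M L f) := by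
  unfold ansatz
  rw [LinearMap.smul_apply, averaging_modelRep, LinearMap.smul_apply, map_smul]

theorem ansatz_comp_modelRep (N S L : OLag V) (g : Heis V) (f : model ψ L.space) :
    (ansatz ψ N S ∘ₗ ansatz ψ S L) (modelRep ψ L.space g f) =
      modelRep ψ N.space g ((ansatz ψ N S ∘ₗ ansatz ψ S L) f) := by
  rw [LinearMap.comp_apply, ansatz_modelRep, ansatz_modelRep, LinearMap.comp_apply]

theorem ansatz_delta {N L : OLag V} (h : N.space ⊓ L.space = ⊥) :
    (ansatz ψ N L (deltaModel ψ L.space L.lagrangian.ge)).1 1 = normConst ψ N L := by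
  change normConst ψ N L * ∑ n : N.space, (deltaModel ψ L.space L.lagrangian.ge).1
    (Heis.ofVec (n : V) * 1) = _
  rw [Finset.sum_eq_single 0]
  · have : Heis.ofVec ((0 : N.space) : V) * 1 = 1 := mul_one _
    rw [this, deltaModel_apply_one, mul_one]
  · intro n _ hn
    apply deltaModel_of_notMem
    rw [mul_one]
    intro hmem
    apply hn
    have : (n : V) ∈ N.space ⊓ L.space := ⟨n.2, hmem⟩
    rw [h, Submodule.mem_bot] at this
    exact Subtype.ext this
  · intro h; exact absurd (Finset.mem_univ _) h

theorem ansatz_comp_independent (hF : ringChar F ≠ 2) (hψ : ψ ≠ 1) {L N S S' : OLag V}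
    (hSL : S.space ⊓ L.space = ⊥) (hSN : S.space ⊓ N.space = ⊥)
    (hSL' : S'.space ⊓ L.space = ⊥) (hSN' : S'.space ⊓ N.space = ⊥) :
    ansatz ψ N S ∘ₗ ansatz ψ S L = ansatz ψ N S' ∘ₗ ansatz ψ S' L := by
  obtain ⟨i, r, bI, k, m, a, b, hI, hk, hm⟩ := L.exists_adapted_bases N
  refine intertwiner_ext ψ (Ring.two_ne_zero hF) hψ N.lagrangian L.lagrangian
    (ansatz_comp_modelRep ψ _ _ _) (ansatz_comp_modelRep ψ _ _ _) ?_
  exact (ansatz_comp_delta ψ hF hψ hSL hSN hI hk hm).trans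
    (ansatz_comp_delta ψ hF hψ hSL' hSN' hI hk hm).symm

/-- Here `L ∩ N` is all of `L`, so `r = 0` and the remaining determinant is empty. Both adapted
bases then consist of `bI` alone, so `a = b` and σ(ab) = 1. -/
theorem ansatz_comp_self (hF : ringChar F ≠ 2) (hψ : ψ ≠ 1) {L S : OLag V}
    (hSL : S.space ⊓ L.space = ⊥) : ansatz ψ L S ∘ₗ ansatz ψ S L = LinearMap.id := by
  obtain ⟨i, r, bI, k, m, a, b, hI, hk, hm⟩ := L.exists_adapted_bases L
  refine intertwiner_ext ψ (Ring.two_ne_zero hF) hψ L.lagrangian L.lagrangian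
    (ansatz_comp_modelRep ψ _ _ _) (fun _ _ => rfl) ?_
  refine (ansatz_comp_delta ψ hF hψ hSL hSL hI hk hm).trans ?_
  have hr : r = 0 := by
    have h1 := hI.finrank_eq
    rw [inf_idem, L.finrank_eq, ← hk.eq_halfDim] at h1
    omega
  subst hr
  have hab : a = b := by
    have h1 : k = m := Subsingleton.elim _ _
    have h2 := hk.vec_eq.symm.trans hm.vec_eq
    rw [h1] at h2
    exact smul_left_injective F hm.ιMulti_ne_zero h2
  subst hab
  rw [LinearMap.id_apply, deltaModel_apply_one, Matrix.det_fin_zero, mul_one, ← sq,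
    quadraticChar_sq_one' hk.ne_zero]
  simp

/-- Now `i = 0`, and the general value is the normalization constant of the pair. -/
theorem ansatz_comp_of_generalPosition (hF : ringChar F ≠ 2) (hψ : ψ ≠ 1) {L N S : OLag V}
    (hSL : S.space ⊓ L.space = ⊥) (hSN : S.space ⊓ N.space = ⊥) (hNL : N.space ⊓ L.space = ⊥) :
    ansatz ψ N S ∘ₗ ansatz ψ S L = ansatz ψ N L := by
  obtain ⟨i, r, bI, k, m, a, b, hI, hk, hm⟩ := L.exists_adapted_bases N
  refine intertwiner_ext ψ (Ring.two_ne_zero hF) hψ N.lagrangian L.lagrangian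
    (ansatz_comp_modelRep ψ _ _ _) (ansatz_modelRep ψ _ _) ?_
  refine (ansatz_comp_delta ψ hF hψ hSL hSN hI hk hm).trans ?_
  have hi : i = 0 := by
    rw [← hI.finrank_eq, inf_comm, hNL, finrank_bot]
  subst hi
  rw [ansatz_delta ψ hNL, normConst_eq ψ finSumFinEquiv.symm hk hm, zero_add,
    ← Matrix.det_submatrix_equiv_self (Equiv.emptySum (Fin 0) (Fin r)).symm
      (Matrix.of fun i j => V.form (Sum.elim bI k i) (Sum.elim bI m j))]
  rfl

theorem exists_isCanonicalSystem (hF : ringChar F ≠ 2) (hψ : ψ ≠ 1) (V : SympSpace.{u, v} F) :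
    ∃ T : System ψ V, IsCanonicalSystem ψ T := by
  choose S hSN hSL using fun N L : OLag V => N.exists_generalPosition L
  simp only [generalPosition_iff] at hSN hSL
  have hSN' : ∀ N L, (S N L).space ⊓ N.space = ⊥ := fun N L => by rw [inf_comm]; exact hSN N L
  let T : System ψ V := fun N L => ansatz ψ N (S N L) ∘ₗ ansatz ψ (S N L) L
  have hT : ∀ N L S' : OLag V, S'.space ⊓ N.space = ⊥ → S'.space ⊓ L.space = ⊥ →
      T N L = ansatz ψ N S' ∘ₗ ansatz ψ S' L := fun N L S' h1 h2 =>
    ansatz_comp_independent ψ hF hψ (hSL N L) (hSN' N L) h2 h1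
  refine ⟨T, isTrivialization_of_mul ψ (fun _ _ => ansatz_comp_modelRep ψ _ _ _) ?_ ?_, ?_⟩
  · intro N M L
    -- All three maps are rewritten through one common transversal `S'`; the inner passage from `S'`
    -- to `M` and back is the identity.
    obtain ⟨S', h1, h2, h3⟩ := OLag.exists_generalPosition_three (Ring.two_ne_zero hF) N M L
    rw [hT N M S' h1 h2, hT M L S' h2 h3, hT N L S' h1 h3, LinearMap.comp_assoc,
      ← LinearMap.comp_assoc (ansatz ψ S' L),
      ansatz_comp_self ψ hF hψ (by rw [inf_comm]; exact h2), LinearMap.id_comp]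
  · intro L
    exact ansatz_comp_self ψ hF hψ (hSL L L)
  · intro M L h
    exact ansatz_comp_of_generalPosition ψ hF hψ (hSL M L) (hSN' M L) (generalPosition_iff.mp h)

theorem isCanonicalSystem_canonicalSystem (hF : ringChar F ≠ 2) (hψ : ψ ≠ 1)
    (V : SympSpace.{u, v} F) : IsCanonicalSystem ψ (canonicalSystem ψ V) := by
  obtain ⟨T, hT⟩ := exists_isCanonicalSystem ψ hF hψ V
  rwa [canonicalSystem_eq ψ hT]

theorem canonicalSystem_self (hF : ringChar F ≠ 2) (hψ : ψ ≠ 1) (L : OLag V) :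
    canonicalSystem ψ V L L = LinearMap.id := by
  have h := isCanonicalSystem_canonicalSystem ψ hF hψ V
  apply LinearMap.ext; intro f
  exact (h.bijective L L).injective (LinearMap.congr_fun (h.mul L L L) f)

/-- Valid for every pair, transversal or not. Reduction needs this, since the lifts of two
Lagrangians always share `I`. -/
theorem canonicalSystem_delta (hF : ringChar F ≠ 2) (hψ : ψ ≠ 1) {L N : OLag V}
    {i r : ℕ} {bI : Fin i → V} {k m : Fin r → V} {a b : F}
    (hI : IsBasisOf bI (L.space ⊓ N.space))
    (hk : IsOrientedBasis L.toOSubspace (Sum.elim bI k ∘ finSumFinEquiv.symm) a)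
    (hm : IsOrientedBasis N.toOSubspace (Sum.elim bI m ∘ finSumFinEquiv.symm) b) :
    (canonicalSystem ψ V N L (deltaModel ψ L.space L.lagrangian.ge)).1 1 =
    (gaussSumOne ψ / (Fintype.card F : ℂ)) ^ r *
      quadraticChar F (a * b * (Matrix.of fun a b => V.form (k a) (m b)).det) := by
  have h := isCanonicalSystem_canonicalSystem ψ hF hψ V
  obtain ⟨S, h1, h2⟩ := N.exists_generalPosition L
  rw [← h.mul N S L, h.eq_ansatz N S h1, h.eq_ansatz S L h2]
  rw [generalPosition_iff] at h1 h2
  exact ansatz_comp_delta ψ hF hψ h2 (by rw [inf_comm]; exact h1) hI hk hm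

end Existence

/-! ### The projection from `I^⊥` to `I^⊥/I`, a section, and lifts of Lagrangians -/

section ReductionMaps

variable {F : Type u} [Field F] {V U : SympSpace.{u, v} F}

/-- A map on all of `V` avoids elements of subtypes. Its values off `I^⊥` are arbitrary, so
constructions that use it are cut off by membership in `I^⊥`. -/
theorem exists_redProj (I : OIso V) : ∃ q : V →ₗ[F] reduction V I,
    ∀ x (hx : x ∈ V.perp I.space),
      q x = (Submodule.Quotient.mk (⟨x, hx⟩ : V.perp I.space) : reduction V I) := by
  let f : V.perp I.space →ₗ[F] reduction V I :=
    (I.space.submoduleOf (V.perp I.space)).mkQ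
  obtain ⟨q, hq⟩ := LinearMap.exists_extend f
  exact ⟨q, fun x hx => LinearMap.congr_fun hq ⟨x, hx⟩⟩

/-- A linear extension to `V` of the projection `I^⊥ → I^⊥ / I`. -/
def redProj (I : OIso V) : V →ₗ[F] reduction V I := (exists_redProj I).choose

theorem redProj_apply (I : OIso V) {x : V} (hx : x ∈ V.perp I.space) :
    redProj I x = (Submodule.Quotient.mk (⟨x, hx⟩ : V.perp I.space) : reduction V I) :=
  (exists_redProj I).choose_spec x hx

theorem redProj_eq_zero_iff (I : OIso V) {x : V} (hx : x ∈ V.perp I.space) :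
    redProj I x = 0 ↔ x ∈ I.space := by
  rw [redProj_apply I hx]
  exact Submodule.Quotient.mk_eq_zero _

theorem form_redProj (I : OIso V) {x y : V} (hx : x ∈ V.perp I.space) (hy : y ∈ V.perp I.space) :
    (reduction V I).form (redProj I x) (redProj I y) = V.form x y := by
  rw [redProj_apply I hx, redProj_apply I hy]
  rfl

theorem reductionMap_redProj (f : SympIso V U) {I : OIso V} {J : OIso U} (hf : I.map f = J)
    {x : V} (hx : x ∈ V.perp I.space) :
    (reductionMap f hf).toLinearEquiv (redProj I x) = redProj J (f.toLinearEquiv x) := by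
  have hx' : f.toLinearEquiv x ∈ U.perp J.space := by
    subst hf
    exact (f.map_perp I.space).le (Submodule.mem_map_of_mem hx)
  rw [redProj_apply I hx, redProj_apply J hx']
  rfl

theorem exists_redSection (I : OIso V) : ∃ s : reduction V I →ₗ[F] V,
    ∀ w, s w ∈ V.perp I.space ∧ redProj I (s w) = w := by
  let f : V.perp I.space →ₗ[F] reduction V I :=
    (I.space.submoduleOf (V.perp I.space)).mkQ
  obtain ⟨g, hg⟩ := f.exists_rightInverse_of_surjective
    (LinearMap.range_eq_top.mpr (Submodule.mkQ_surjective _))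
  refine ⟨(V.perp I.space).subtype ∘ₗ g, fun w => ⟨(g w).2, ?_⟩⟩
  rw [redProj_apply I (x := ((V.perp I.space).subtype ∘ₗ g) w) (g w).2]
  exact LinearMap.congr_fun hg w

/-- A linear section of the projection `I^⊥ → I^⊥ / I`. -/
def redSection (I : OIso V) : reduction V I →ₗ[F] V := (exists_redSection I).choose

theorem redSection_mem (I : OIso V) (w : reduction V I) : redSection I w ∈ V.perp I.space :=
  ((exists_redSection I).choose_spec w).1

theorem redProj_redSection (I : OIso V) (w : reduction V I) : redProj I (redSection I w) = w :=
  ((exists_redSection I).choose_spec w).2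

theorem form_redSection (I : OIso V) (w w' : reduction V I) :
    V.form (redSection I w) (redSection I w') = (reduction V I).form w w' := by
  rw [← form_redProj I (redSection_mem I w) (redSection_mem I w'), redProj_redSection,
    redProj_redSection]

theorem sub_redSection_mem (I : OIso V) {x : V} (hx : x ∈ V.perp I.space) :
    x - redSection I (redProj I x) ∈ I.space := by
  rw [← redProj_eq_zero_iff I ((V.perp I.space).sub_mem hx (redSection_mem I _)), map_sub,
    redProj_redSection, sub_self]

/-- The preimage in `I^⊥` of a subspace of `I^⊥ / I`. -/
def liftSpace (I : OIso V) (N : Submodule F (reduction V I)) : Submodule F V :=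
  V.perp I.space ⊓ N.comap (redProj I)

variable {I : OIso V} {N M : Submodule F (reduction V I)}

theorem le_liftSpace : I.space ≤ liftSpace I N := fun x hx =>
  ⟨I.isotropic hx, by
    rw [SetLike.mem_coe, Submodule.mem_comap, (redProj_eq_zero_iff I (I.isotropic hx)).mpr hx]
    exact N.zero_mem⟩

theorem redSection_mem_liftSpace {w : reduction V I} (hw : w ∈ N) :
    redSection I w ∈ liftSpace I N :=
  ⟨redSection_mem I w, by rw [SetLike.mem_coe, Submodule.mem_comap, redProj_redSection]; exact hw⟩

/-- A vector orthogonal to the lift is orthogonal to `I`, hence lies in `I^⊥`, where the form can be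
computed in the reduction. -/
theorem perp_liftSpace (hN : (reduction V I).perp N = N) :
    V.perp (liftSpace I N) = liftSpace I N := by
  ext x
  constructor
  · intro hx
    have hxI : x ∈ V.perp I.space := V.perp_anti le_liftSpace hx
    refine ⟨hxI, ?_⟩
    rw [SetLike.mem_coe, Submodule.mem_comap, ← hN]
    intro w hw
    rw [← redProj_redSection I w, form_redProj I (redSection_mem I w) hxI]
    exact hx _ (redSection_mem_liftSpace hw)
  · rintro ⟨hxI, hx⟩ y ⟨hyI, hy⟩
    rw [← form_redProj I hyI hxI]
    exact hN.ge hx _ hy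

theorem liftSpace_inf_liftSpace (h : N ⊓ M = ⊥) : liftSpace I N ⊓ liftSpace I M = I.space := by
  apply le_antisymm
  · rintro x ⟨⟨hxI, hxN⟩, -, hxM⟩
    rw [← redProj_eq_zero_iff I hxI, ← Submodule.mem_bot F, ← h]
    exact ⟨hxN, hxM⟩
  · exact le_inf le_liftSpace le_liftSpace

theorem IsBasisOf.liftSpace {ι κ : Type*} {bI : ι → V} {k : κ → reduction V I}
    (hI : IsBasisOf bI I.space) (hk : IsBasisOf k N) :
    IsBasisOf (Sum.elim bI (redSection I ∘ k)) (liftSpace I N) where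
  linearIndependent := by
    refine hI.linearIndependent.sum_type (hk.linearIndependent.map' _ ?_) ?_
    · rw [LinearMap.ker_eq_bot]
      exact Function.LeftInverse.injective (redProj_redSection I)
    · rw [hI.span_eq, Set.range_comp, Submodule.span_image, Submodule.disjoint_def]
      rintro _ hx ⟨w, -, rfl⟩
      rw [← redProj_eq_zero_iff I (redSection_mem I w), redProj_redSection] at hx
      rw [hx, map_zero]
  span_eq := by
    rw [Set.Sum.elim_range, Submodule.span_union, hI.span_eq, Set.range_comp,
      Submodule.span_image, hk.span_eq]
    apply le_antisymm
    · refine sup_le le_liftSpace ?_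
      rintro _ ⟨w, hw, rfl⟩
      exact redSection_mem_liftSpace hw
    · rintro x ⟨hxI, hx⟩
      exact Submodule.mem_sup.mpr ⟨_, sub_redSection_mem I hxI, _,
        Submodule.mem_map_of_mem hx, sub_add_cancel _ _⟩

end ReductionMaps

/-! ### Orientations of lifted Lagrangians -/

section LiftOrientation

variable {F : Type u} [Field F]

theorem ιMulti_mul_ιMulti {E : Type v} [AddCommGroup E] [Module F E] {i r : ℕ} (b : Fin i → E)
    (k : Fin r → E) :
    ExteriorAlgebra.ιMulti F i b * ExteriorAlgebra.ιMulti F r k =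
      ExteriorAlgebra.ιMulti F (i + r) (Sum.elim b k ∘ finSumFinEquiv.symm) := by
  have h : (fun j => ExteriorAlgebra.ι F ((Sum.elim b k ∘ finSumFinEquiv.symm) j)) =
      Fin.append (fun j => ExteriorAlgebra.ι F (b j)) fun j => ExteriorAlgebra.ι F (k j) := by
    funext j
    refine Fin.addCases (fun a => ?_) (fun a => ?_) j <;> simp
  rw [ExteriorAlgebra.ιMulti_apply, ExteriorAlgebra.ιMulti_apply, ExteriorAlgebra.ιMulti_apply, h,
    List.ofFn_fin_append, List.prod_append]

/-- Used to move a vector through an arbitrary element until it stands next to `o_I`. -/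
theorem exists_mul_ι_eq {E : Type v} [AddCommGroup E] [Module F E] (x : E)
    (z : ExteriorAlgebra F E) : ∃ z', z * ExteriorAlgebra.ι F x = ExteriorAlgebra.ι F x * z' := by
  induction z using ExteriorAlgebra.induction with
  | algebraMap c => exact ⟨algebraMap F _ c, Algebra.commutes c _⟩
  | ι y => exact ⟨-ExteriorAlgebra.ι F y, by
      rw [mul_neg, eq_neg_iff_add_eq_zero, ExteriorAlgebra.ι_add_mul_swap]⟩
  | mul a b ha hb =>
    obtain ⟨a', ha⟩ := ha
    obtain ⟨b', hb⟩ := hb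
    exact ⟨a' * b', by rw [mul_assoc, hb, ← mul_assoc, ha, mul_assoc]⟩
  | add a b ha hb =>
    obtain ⟨a', ha⟩ := ha
    obtain ⟨b', hb⟩ := hb
    exact ⟨a' + b', by rw [add_mul, ha, hb, mul_add]⟩

variable {V U : SympSpace.{u, v} F}

theorem OSubspace.exists_isOrientedBasis (I : OSubspace V) :
    ∃ (i : ℕ) (b : Fin i → V) (a : F), IsOrientedBasis I b a := by
  obtain ⟨a, ha⟩ := (IsBasisOf.of_basis (Module.finBasis F I.space)).exists_isOrientedBasis (L := I)
  exact ⟨_, _, a, ha⟩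

theorem OSubspace.vec_mul_ι (I : OSubspace V) {x : V} (hx : x ∈ I.space) :
    I.vec * ExteriorAlgebra.ι F x = 0 := by
  obtain ⟨i, b, a, h⟩ := I.exists_isOrientedBasis
  have h1 : ExteriorAlgebra.ι F x = ExteriorAlgebra.ιMulti F 1 fun _ => x := by
    rw [ExteriorAlgebra.ιMulti_apply]; simp
  rw [h.vec_eq, h1, smul_mul_assoc, ιMulti_mul_ιMulti, AlternatingMap.map_linearDependent,
    smul_zero]
  intro hli
  have h2 := (linearIndependent_equiv finSumFinEquiv.symm).mp hli
  have h3 := linearIndependent_sum.mp h2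
  have h4 := Submodule.disjoint_def.mp h3.2.2 x (by
    change x ∈ Submodule.span F (Set.range b)
    rw [h.span_eq]; exact hx) (Submodule.subset_span ⟨0, rfl⟩)
  exact h3.2.1.ne_zero (0 : Fin 1) h4

/-- Multiplication by `o_I` annihilates every product containing a vector of `I`. Hence the
orientation of a lift does not depend on the chosen section. -/
theorem OSubspace.vec_mul_map_eq {E : Type v} [AddCommGroup E] [Module F E] (I : OSubspace V)
    {f g : E →ₗ[F] V} (h : ∀ x, f x - g x ∈ I.space) (z : ExteriorAlgebra F E) :
    I.vec * ExteriorAlgebra.map f z = I.vec * ExteriorAlgebra.map g z := by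
  induction z using CliffordAlgebra.right_induction with
  | algebraMap c => rw [AlgHom.commutes, AlgHom.commutes]
  | add a b ha hb => rw [map_add, map_add, mul_add, mul_add, ha, hb]
  | mul_ι m x hx =>
    have e1 : ExteriorAlgebra.map f (x * ExteriorAlgebra.ι F m) =
        ExteriorAlgebra.map f x * ExteriorAlgebra.ι F (f m) := by
      rw [map_mul, ExteriorAlgebra.map_apply_ι]
    have e2 : ExteriorAlgebra.map g (x * ExteriorAlgebra.ι F m) =
        ExteriorAlgebra.map g x * ExteriorAlgebra.ι F (g m) := by
      rw [map_mul, ExteriorAlgebra.map_apply_ι]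
    change I.vec * ExteriorAlgebra.map f (x * ExteriorAlgebra.ι F m) =
      I.vec * ExteriorAlgebra.map g (x * ExteriorAlgebra.ι F m)
    obtain ⟨z', hz⟩ := exists_mul_ι_eq (F := F) (f m - g m) (ExteriorAlgebra.map g x)
    have e3 : I.vec * (ExteriorAlgebra.map g x * ExteriorAlgebra.ι F (f m - g m)) = 0 := by
      rw [hz, ← mul_assoc, I.vec_mul_ι (h m), zero_mul]
    rw [map_sub, mul_sub, mul_sub, sub_eq_zero] at e3
    rw [e1, e2, ← mul_assoc, hx, mul_assoc, e3]

/-- The orientation of the preimage in `I^⊥` of an oriented subspace of `I^⊥ / I`. -/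
def liftVec (I : OIso V) (N : OSubspace (reduction V I)) : ExteriorAlgebra F V :=
  I.vec * ExteriorAlgebra.map (redSection I) N.vec

theorem liftVec_eq (I : OIso V) (N : OSubspace (reduction V I)) {i r : ℕ} {bI : Fin i → V}
    {k : Fin r → reduction V I} {a b : F} (hI : IsOrientedBasis I.toOSubspace bI a)
    (hk : IsOrientedBasis N k b) :
    liftVec I N = (a * b) • ExteriorAlgebra.ιMulti F (i + r)
      (Sum.elim bI (redSection I ∘ k) ∘ finSumFinEquiv.symm) := by
  unfold liftVec
  rw [hI.vec_eq, hk.vec_eq, map_smul, ExteriorAlgebra.map_apply_ιMulti, smul_mul_smul_comm,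
    ιMulti_mul_ιMulti]

/-- The preimage in `I^⊥` of an oriented Lagrangian of `I^⊥ / I`, with the orientation induced
by the one of `I`. -/
def liftOLag (I : OIso V) (N : OLag (reduction V I)) : OLag V where
  space := liftSpace I N.space
  vec := liftVec I N.toOSubspace
  vec_mem := by
    obtain ⟨i, bI, a, hI⟩ := I.toOSubspace.exists_isOrientedBasis
    obtain ⟨r, k, b, hk⟩ := N.toOSubspace.exists_isOrientedBasis
    rw [liftVec_eq I _ hI hk]
    exact Submodule.smul_mem _ _ ((hI.toIsBasisOf.liftSpace hk.toIsBasisOf).comp_equiv _).ιMulti_mem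
  vec_ne := by
    obtain ⟨i, bI, a, hI⟩ := I.toOSubspace.exists_isOrientedBasis
    obtain ⟨r, k, b, hk⟩ := N.toOSubspace.exists_isOrientedBasis
    rw [liftVec_eq I _ hI hk]
    exact smul_ne_zero (mul_ne_zero hI.ne_zero hk.ne_zero)
      ((hI.toIsBasisOf.liftSpace hk.toIsBasisOf).comp_equiv _).ιMulti_ne_zero
  lagrangian := perp_liftSpace N.lagrangian

theorem IsOrientedBasis.liftOLag {I : OIso V} {N : OLag (reduction V I)} {i r : ℕ}
    {bI : Fin i → V} {k : Fin r → reduction V I} {a b : F}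
    (hI : IsOrientedBasis I.toOSubspace bI a) (hk : IsOrientedBasis N.toOSubspace k b) :
    IsOrientedBasis (liftOLag I N).toOSubspace
      (Sum.elim bI (redSection I ∘ k) ∘ finSumFinEquiv.symm) (a * b) where
  toIsBasisOf := (hI.toIsBasisOf.liftSpace hk.toIsBasisOf).comp_equiv _
  vec_eq := liftVec_eq I _ hI hk

theorem liftOLag_map (f : SympIso V U) {I : OIso V} {J : OIso U} (hf : I.map f = J)
    (N : OLag (reduction V I)) :
    (liftOLag I N).map f = liftOLag J (N.map (reductionMap f hf)) := by
  have hmem : ∀ {x : V}, f.toLinearEquiv x ∈ U.perp J.space ↔ x ∈ V.perp I.space := by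
    subst hf
    intro x
    change _ ∈ U.perp (I.space.map (f.toLinearEquiv : V →ₗ[F] U)) ↔ _
    rw [← f.map_perp, Submodule.mem_map_equiv, LinearEquiv.symm_apply_apply]
  apply OLag.ext
  · change (liftSpace I N.space).map _ = liftSpace J (N.space.map _)
    ext y
    obtain ⟨x, rfl⟩ := f.toLinearEquiv.surjective y
    constructor
    · rintro ⟨z, ⟨hzI, hz⟩, hzx⟩
      obtain rfl := f.toLinearEquiv.injective hzx
      refine ⟨hmem.mpr hzI, ?_⟩
      rw [SetLike.mem_coe, Submodule.mem_comap, ← reductionMap_redProj f hf hzI]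
      exact Submodule.mem_map_of_mem hz
    · rintro ⟨hxI, hx⟩
      have hxI' := hmem.mp hxI
      rw [SetLike.mem_coe, Submodule.mem_comap, ← reductionMap_redProj f hf hxI'] at hx
      obtain ⟨w, hw, hwx⟩ := hx
      obtain rfl := (reductionMap f hf).toLinearEquiv.injective hwx
      exact ⟨x, ⟨hxI', hw⟩, rfl⟩
  · change ExteriorAlgebra.map (f.toLinearEquiv : V →ₗ[F] U) (liftVec I N.toOSubspace) =
      J.vec * ExteriorAlgebra.map (redSection J) (ExteriorAlgebra.map
        ((reductionMap f hf).toLinearEquiv : reduction V I →ₗ[F] reduction U J) N.vec)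
    have hJ : ExteriorAlgebra.map (f.toLinearEquiv : V →ₗ[F] U) I.vec = J.vec := by
      subst hf; rfl
    unfold liftVec
    rw [map_mul, hJ, map_map_ext, map_map_ext]
    -- Applying `f` to the section of `I`, or the section of `J` to the induced map, gives two lifts
    -- of the same vector of `J^⊥/J`, which differ by an element of `J`.
    refine J.toOSubspace.vec_mul_map_eq (fun w => ?_) _
    have h1 := redSection_mem I w
    have h2 := sub_redSection_mem J (hmem.mpr h1)
    rw [← reductionMap_redProj f hf h1, redProj_redSection] at h2
    exact h2

end LiftOrientation

/-! ### Invariant functions in the model of a lift -/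

section ModelReduction

variable {F : Type u} [Field F] (ψ : AddChar F ℂ) {V U : SympSpace.{u, v} F}

/-- Restriction of functions from `H(V)` to `H(I^⊥ / I)` along the section of `I^⊥ → I^⊥ / I`. -/
def restrictModel (I : OIso V) (N : Submodule F (reduction V I)) :
    model ψ (liftSpace I N) →ₗ[ℂ] model ψ N where
  toFun f := ⟨fun h => f.1 ⟨redSection I h.vec, h.cen⟩, by
    refine ⟨fun z h => ?_, fun l hl h => ?_⟩
    · refine (congrArg f.1 (Heis.ext ?_ ?_)).trans (f.2.1 z ⟨redSection I h.vec, h.cen⟩) <;>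
        simp [Heis.mul_def, Heis.ofCen]
    · refine (congrArg f.1 (Heis.ext ?_ ?_)).trans
        (f.2.2 _ (redSection_mem_liftSpace hl) ⟨redSection I h.vec, h.cen⟩) <;>
        simp [Heis.mul_def, Heis.ofVec, form_redSection]⟩
  map_add' _ _ := rfl
  map_smul' _ _ := rfl

open Classical in
/-- Extension by zero of functions on `H(I^⊥ / I)`, pulled back to `I^⊥ × F`, to `H(V)`. -/
def extendModel (I : OIso V) (N : Submodule F (reduction V I)) :
    model ψ N →ₗ[ℂ] model ψ (liftSpace I N) where
  toFun f := ⟨fun h => if h.vec ∈ V.perp I.space then f.1 ⟨redProj I h.vec, h.cen⟩ else 0, by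
    refine ⟨fun z h => ?_, fun l hl h => ?_⟩
    · have e1 : (Heis.ofCen V z * h).vec = h.vec := zero_add _
      beta_reduce
      rw [e1, mul_ite, mul_zero, ← f.2.1]
      refine if_congr Iff.rfl (congrArg f.1 (Heis.ext ?_ ?_)) rfl <;>
        simp [Heis.mul_def, Heis.ofCen]
    · have e1 : (Heis.ofVec l * h).vec = l + h.vec := rfl
      beta_reduce
      rw [e1, Submodule.add_mem_iff_right _ hl.1]
      by_cases hh : h.vec ∈ V.perp I.space
      · rw [if_pos hh, if_pos hh, ← f.2.2 _ hl.2 ⟨redProj I h.vec, h.cen⟩]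
        refine congrArg f.1 (Heis.ext ?_ ?_)
        · simp [Heis.mul_def, Heis.ofVec]
        · simp [Heis.mul_def, Heis.ofVec, form_redProj I hl.1 hh]
      · rw [if_neg hh, if_neg hh]⟩
  map_add' f g := by
    apply Subtype.ext; funext h
    by_cases hh : h.vec ∈ V.perp I.space <;> simp [hh]
  map_smul' c f := by
    apply Subtype.ext; funext h
    by_cases hh : h.vec ∈ V.perp I.space <;> simp [hh]

variable {I : OIso V} {N : Submodule F (reduction V I)}

theorem extendModel_of_mem (f : model ψ N) {h : Heis V} (hh : h.vec ∈ V.perp I.space) :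
    (extendModel ψ I N f).1 h = f.1 ⟨redProj I h.vec, h.cen⟩ := if_pos hh

theorem extendModel_of_notMem (f : model ψ N) {h : Heis V} (hh : h.vec ∉ V.perp I.space) :
    (extendModel ψ I N f).1 h = 0 := if_neg hh

/-- Restriction does not depend on the section: `h.vec` and its chosen representative differ by an
element of `I`, which is orthogonal to `I^⊥` and acts trivially from the left. -/
theorem restrictModel_apply (f : model ψ (liftSpace I N)) {h : Heis V}
    (hh : h.vec ∈ V.perp I.space) :
    (restrictModel ψ I N f).1 ⟨redProj I h.vec, h.cen⟩ = f.1 h := by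
  have hi := sub_redSection_mem I hh
  have hform : V.form (h.vec - redSection I (redProj I h.vec)) (redSection I (redProj I h.vec)) = 0 :=
    redSection_mem I _ _ hi
  change f.1 ⟨redSection I (redProj I h.vec), h.cen⟩ = _
  rw [← f.2.2 _ (le_liftSpace hi) ⟨redSection I (redProj I h.vec), h.cen⟩]
  symm
  refine congrArg f.1 (Heis.ext ?_ ?_)
  · exact (sub_add_cancel _ _).symm
  · symm
    change 0 + h.cen + 2⁻¹ * V.form (h.vec - redSection I (redProj I h.vec))
      (redSection I (redProj I h.vec)) = h.cen
    rw [hform, mul_zero, zero_add, add_zero]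

theorem restrictModel_extendModel (f : model ψ N) :
    restrictModel ψ I N (extendModel ψ I N f) = f := by
  apply Subtype.ext; funext h
  refine (extendModel_of_mem ψ f (h := ⟨redSection I h.vec, h.cen⟩)
    (redSection_mem I h.vec)).trans ?_
  rw [redProj_redSection]

theorem extendModel_invariant (f : model ψ N) {i : V} (hi : i ∈ I.space) :
    modelRep ψ _ (Heis.ofVec i) (extendModel ψ I N f) = extendModel ψ I N f := by
  apply Subtype.ext; funext h
  change (extendModel ψ I N f).1 (h * Heis.ofVec i) = _
  have e1 : (h * Heis.ofVec i).vec = h.vec + i := rfl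
  by_cases hh : h.vec ∈ V.perp I.space
  · rw [extendModel_of_mem ψ f hh, extendModel_of_mem ψ f
      (by rw [e1]; exact (V.perp I.space).add_mem hh (I.isotropic hi)), e1, map_add,
      (redProj_eq_zero_iff I (I.isotropic hi)).mpr hi, add_zero]
    have e2 : V.form h.vec i = 0 := by rw [V.form_swap, hh i hi, neg_zero]
    simp [Heis.mul_def, Heis.ofVec, e2]
  · rw [extendModel_of_notMem ψ f hh, extendModel_of_notMem ψ f]
    rwa [e1, Submodule.add_mem_iff_left _ (I.isotropic hi)]

/-- Invariance under `I` forces `f` to vanish off `I^⊥`, so nothing is lost by restricting. -/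
theorem extendModel_restrictModel (h2 : (2 : F) ≠ 0) (hψ : ψ ≠ 1) (f : model ψ (liftSpace I N))
    (hf : ∀ i ∈ I.space, modelRep ψ _ (Heis.ofVec i) f = f) :
    extendModel ψ I N (restrictModel ψ I N f) = f := by
  apply Subtype.ext; funext h
  by_cases hh : h.vec ∈ V.perp I.space
  · rw [extendModel_of_mem ψ _ hh, restrictModel_apply ψ f hh]
  · rw [extendModel_of_notMem ψ _ hh,
      apply_eq_zero_of_not_mem_perp ψ h2 hψ le_liftSpace f hf hh]

theorem restrictModel_modelRep (g : Heis (reduction V I)) (f : model ψ (liftSpace I N)) :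
    restrictModel ψ I N (modelRep ψ _ ⟨redSection I g.vec, g.cen⟩ f) =
      modelRep ψ N g (restrictModel ψ I N f) := by
  apply Subtype.ext; funext h
  refine congrArg f.1 (Heis.ext ?_ ?_) <;> simp [Heis.mul_def, form_redSection]

theorem extendModel_modelRep (g : Heis (reduction V I)) (f : model ψ N) :
    extendModel ψ I N (modelRep ψ N g f) =
      modelRep ψ _ ⟨redSection I g.vec, g.cen⟩ (extendModel ψ I N f) := by
  apply Subtype.ext; funext h
  change _ = (extendModel ψ I N f).1 (h * ⟨redSection I g.vec, g.cen⟩)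
  have e1 : (h * ⟨redSection I g.vec, g.cen⟩ : Heis V).vec = h.vec + redSection I g.vec := rfl
  by_cases hh : h.vec ∈ V.perp I.space
  · rw [extendModel_of_mem ψ _ hh, extendModel_of_mem ψ f
      (by rw [e1]; exact (V.perp I.space).add_mem hh (redSection_mem I _))]
    refine congrArg f.1 (Heis.ext ?_ ?_)
    · simp [Heis.mul_def, redProj_redSection]
    · simp [Heis.mul_def, ← form_redProj I hh (redSection_mem I _), redProj_redSection]
  · rw [extendModel_of_notMem ψ _ hh, extendModel_of_notMem ψ f]
    rwa [e1, Submodule.add_mem_iff_left _ (redSection_mem I _)]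

/-- Allows intertwiners of the reduction to be identified by their values on the δ-functions of `V`.
-/
theorem extendModel_deltaModel (hN : (reduction V I).perp N = N) :
    extendModel ψ I N (deltaModel ψ N hN.ge) =
      deltaModel ψ (liftSpace I N) (perp_liftSpace hN).ge := by
  apply Subtype.ext; funext h
  by_cases hh : h.vec ∈ V.perp I.space
  · rw [extendModel_of_mem ψ _ hh]
    by_cases hn : redProj I h.vec ∈ N
    · rw [deltaModel_of_mem ψ _ (h := ⟨redProj I h.vec, h.cen⟩) hn,
        deltaModel_of_mem ψ (L := liftSpace I N) _ (h := h) ⟨hh, hn⟩]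
    · rw [deltaModel_of_notMem ψ _ (h := ⟨redProj I h.vec, h.cen⟩) hn,
        deltaModel_of_notMem ψ (L := liftSpace I N) _ (h := h) fun hmem => hn hmem.2]
  · rw [extendModel_of_notMem ψ _ hh, deltaModel_of_notMem ψ (L := liftSpace I N) _
      (h := h) fun hmem => hh hmem.1]

theorem restrictModel_apply_one (f : model ψ (liftSpace I N)) :
    (restrictModel ψ I N f).1 1 = f.1 1 := by
  have := restrictModel_apply ψ f (h := 1) (V.perp I.space).zero_mem
  rw [← this]
  exact congrArg _ (Heis.ext (map_zero (redProj I)).symm rfl)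

end ModelReduction

/-! ### The canonical system of the reduction and the isomorphism α -/

section CanonicalReduction

variable {F : Type u} [Field F] [Fintype F] [DecidableEq F] (ψ : AddChar F ℂ)
variable {V U : SympSpace.{u, v} F}

/-- The system on `I^⊥ / I` induced by the canonical system of `V`. -/
def reducedSystem (I : OIso V) : System ψ (reduction V I) := fun M N =>
  restrictModel ψ I M.space ∘ₗ canonicalSystem ψ V (liftOLag I M) (liftOLag I N) ∘ₗ
    extendModel ψ I N.space

theorem canonicalSystem_invariant {M L : OLag V} {i : V} {f : model ψ L.space}
    (hf : modelRep ψ _ (Heis.ofVec i) f = f) :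
    modelRep ψ _ (Heis.ofVec i) (canonicalSystem ψ V M L f) = canonicalSystem ψ V M L f := by
  rw [← canonicalSystem_modelRep, hf]

/-- Extension undoes restriction only on `I`-invariant functions; intertwining maps preserve these.
-/
theorem extend_reducedSystem (hF : ringChar F ≠ 2) (hψ : ψ ≠ 1) (I : OIso V)
    (M N : OLag (reduction V I)) (f : model ψ N.space) :
    extendModel ψ I M.space (reducedSystem ψ I M N f) =
      canonicalSystem ψ V (liftOLag I M) (liftOLag I N) (extendModel ψ I N.space f) :=
  extendModel_restrictModel ψ (Ring.two_ne_zero hF) hψ _ fun _ hi =>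
    canonicalSystem_invariant ψ (L := liftOLag I N) (extendModel_invariant ψ f hi)

/-- The heart of the reduction. For transversal `M` and `N` the lifts intersect in `I`, so
`canonicalSystem_delta` yields the exponent `r` belonging to `I^⊥/I` rather than to `V`, together
with the pairing of `M` and `N` in the reduction. -/
theorem isCanonicalSystem_reducedSystem (hF : ringChar F ≠ 2) (hψ : ψ ≠ 1) (I : OIso V) :
    IsCanonicalSystem ψ (reducedSystem ψ I) := by
  have hint : ∀ (M N : OLag (reduction V I)) (g : Heis (reduction V I)) (f : model ψ N.space),
      reducedSystem ψ I M N (modelRep ψ N.space g f) =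
        modelRep ψ M.space g (reducedSystem ψ I M N f) := by
    intro M N g f
    change restrictModel ψ I M.space (canonicalSystem ψ V (liftOLag I M) (liftOLag I N)
      (extendModel ψ I N.space (modelRep ψ N.space g f))) = _
    rw [extendModel_modelRep]
    exact (congrArg (restrictModel ψ I M.space) (canonicalSystem_modelRep ψ (liftOLag I M)
      (liftOLag I N) _ _)).trans (restrictModel_modelRep ψ g _)
  refine ⟨isTrivialization_of_mul ψ hint ?_ ?_, ?_⟩
  · intro K M N
    apply LinearMap.ext; intro f
    change restrictModel ψ I K.space (canonicalSystem ψ V (liftOLag I K) (liftOLag I M)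
      (extendModel ψ I M.space (reducedSystem ψ I M N f))) = _
    rw [extend_reducedSystem ψ hF hψ]
    exact congrArg (restrictModel ψ I K.space) (LinearMap.congr_fun
      ((isCanonicalSystem_canonicalSystem ψ hF hψ V).mul _ _ _) _)
  · intro N
    apply LinearMap.ext; intro f
    change restrictModel ψ I N.space (canonicalSystem ψ V (liftOLag I N) (liftOLag I N)
      (extendModel ψ I N.space f)) = _
    rw [canonicalSystem_self ψ hF hψ]
    exact restrictModel_extendModel ψ f
  · intro M N h
    rw [generalPosition_iff, inf_comm] at h
    refine intertwiner_ext ψ (Ring.two_ne_zero hF) hψ M.lagrangian N.lagrangian (hint M N)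
      (ansatz_modelRep ψ M N) ?_
    refine Eq.trans ?_ (ansatz_delta ψ (by rwa [inf_comm])).symm
    obtain ⟨i, bI, c, hI⟩ := I.toOSubspace.exists_isOrientedBasis
    obtain ⟨r, k, a, hk⟩ := N.toOSubspace.exists_isOrientedBasis
    obtain ⟨r', m, b, hm⟩ := M.toOSubspace.exists_isOrientedBasis
    obtain rfl : r = r' := hk.eq_halfDim.trans hm.eq_halfDim.symm
    refine (restrictModel_apply_one ψ _).trans ?_
    have hI' : IsBasisOf bI ((liftOLag I N).space ⊓ (liftOLag I M).space) := by
      have : (liftOLag I N).space ⊓ (liftOLag I M).space = I.space := liftSpace_inf_liftSpace h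
      rw [this]
      exact hI.toIsBasisOf
    change (canonicalSystem ψ V (liftOLag I M) (liftOLag I N)
      (extendModel ψ I N.space (deltaModel ψ N.space N.lagrangian.ge))).1 1 = _
    rw [extendModel_deltaModel ψ N.lagrangian]
    refine (canonicalSystem_delta ψ hF hψ hI' (hI.liftOLag hk) (hI.liftOLag hm)).trans ?_
    rw [normConst_eq ψ (Equiv.refl _) hk hm]
    congr 2
    -- The orientation `c` of `I` enters through both lifts, hence as a square.
    have hc := quadraticChar_sq_one' hI.ne_zero
    have e : c * a * (c * b) * (Matrix.of fun a b => V.form ((redSection I ∘ k) a)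
        ((redSection I ∘ m) b)).det = c ^ 2 * (a * b * (Matrix.of fun i j =>
          (reduction V I).form (k i) (m j)).det) := by
      simp only [Function.comp_apply, form_redSection]
      ring
    rw [e, map_mul, hc, one_mul]

theorem canonicalSystem_reduction (hF : ringChar F ≠ 2) (hψ : ψ ≠ 1) (I : OIso V) :
    canonicalSystem ψ (reduction V I) = reducedSystem ψ I :=
  canonicalSystem_eq ψ (isCanonicalSystem_reducedSystem ψ hF hψ I)

theorem modelRep_of_mem_invariantSpace {I : Submodule F V} {s : canonicalSpace ψ V}
    (hs : s ∈ invariantSpace ψ I) (L : OLag V) {i : V} (hi : i ∈ I) :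
    modelRep ψ L.space (Heis.ofVec i) (s.1 L) = s.1 L :=
  congrFun (congrArg Subtype.val (hs i hi)) L

/-- The map `ℋ(V)^I → ℋ(I^⊥ / I)`. -/
def reductionHom (hF : ringChar F ≠ 2) (hψ : ψ ≠ 1) (I : OIso V) :
    invariantSpace ψ I.space →ₗ[ℂ] canonicalSpace ψ (reduction V I) where
  toFun s := ⟨fun N => restrictModel ψ I N.space (s.1.1 (liftOLag I N)), fun M N => by
    -- In `reducedSystem` the extension cancels the restriction by `I`-invariance of `s`, and
    -- horizontality of `s` in `V` remains.
    rw [canonicalSystem_reduction ψ hF hψ]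
    exact congrArg (restrictModel ψ I M.space) ((congrArg
      (canonicalSystem ψ V (liftOLag I M) (liftOLag I N))
      (extendModel_restrictModel ψ (Ring.two_ne_zero hF) hψ _
        fun _ hi => modelRep_of_mem_invariantSpace ψ s.2 (liftOLag I N) hi)).trans
      (s.1.2 (liftOLag I M) (liftOLag I N)))⟩
  map_add' _ _ := by
    apply Subtype.ext; funext N
    exact map_add (restrictModel ψ I N.space) _ _
  map_smul' _ _ := by
    apply Subtype.ext; funext N
    exact map_smul (restrictModel ψ I N.space) _ _

/-- A horizontal section is determined by its value at one Lagrangian, which can be prescribed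
freely. At a lift, restriction is bijective on `I`-invariant functions, with inverse the extension
by zero. -/
theorem reductionHom_bijective (hF : ringChar F ≠ 2) (hψ : ψ ≠ 1) (I : OIso V) :
    Function.Bijective (reductionHom ψ hF hψ I) := by
  obtain ⟨S, hS⟩ := exists_lagrangian (reduction V I)
  obtain ⟨N, -⟩ := exists_oLag hS
  have hcan := isCanonicalSystem_canonicalSystem ψ hF hψ V
  constructor
  · intro s t hst
    have h1 : restrictModel ψ I N.space (s.1.1 (liftOLag I N)) =
        restrictModel ψ I N.space (t.1.1 (liftOLag I N)) :=
      congrFun (congrArg Subtype.val hst) N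
    have key : ∀ s : invariantSpace ψ I.space, extendModel ψ I N.space
        (restrictModel ψ I N.space (s.1.1 (liftOLag I N))) = s.1.1 (liftOLag I N) := fun s =>
      extendModel_restrictModel ψ (Ring.two_ne_zero hF) hψ _
        fun _ hi => modelRep_of_mem_invariantSpace ψ s.2 (liftOLag I N) hi
    have h2 : s.1.1 (liftOLag I N) = t.1.1 (liftOLag I N) :=
      (key s).symm.trans ((congrArg (extendModel ψ I N.space) h1).trans (key t))
    apply Subtype.ext; apply Subtype.ext; funext M
    rw [← s.1.2 M (liftOLag I N), h2]
    exact t.1.2 M (liftOLag I N)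
  · intro t
    let x : model ψ (liftOLag I N).space := extendModel ψ I N.space (t.1 N)
    let s : canonicalSpace ψ V := ⟨fun M => canonicalSystem ψ V M (liftOLag I N) x, fun M L =>
      LinearMap.congr_fun (hcan.mul M L (liftOLag I N)) x⟩
    have hs : s ∈ invariantSpace ψ I.space := by
      intro i hi
      apply Subtype.ext; funext M
      exact canonicalSystem_invariant ψ (extendModel_invariant ψ (t.1 N) hi)
    refine ⟨⟨s, hs⟩, ?_⟩
    apply Subtype.ext; funext M
    rw [← t.2 M N, canonicalSystem_reduction ψ hF hψ]
    rfl

/-- The isomorphism `ℋ(V)^I ≃ ℋ(I^⊥ / I)`. -/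
def reductionEquiv (hF : ringChar F ≠ 2) (hψ : ψ ≠ 1) (V : SympSpace.{u, v} F) (I : OIso V) :
    invariantSpace ψ I.space ≃ₗ[ℂ] canonicalSpace ψ (reduction V I) :=
  LinearEquiv.ofBijective (reductionHom ψ hF hψ I) (reductionHom_bijective ψ hF hψ I)

theorem quant_reductionEquiv (hF : ringChar F ≠ 2) (hψ : ψ ≠ 1) {I : OIso V} {J : OIso U}
    (f : SympIso V U) (hf : I.map f = J) :
    quant ψ (reductionMap f hf) ∘ₗ (reductionEquiv ψ hF hψ U J).toLinearMap =
      (reductionEquiv ψ hF hψ V I).toLinearMap ∘ₗ quantInvariant ψ f hf := by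
  apply LinearMap.ext; intro s
  apply Subtype.ext; funext N; apply Subtype.ext; funext h
  have h1 := redSection_mem I h.vec
  have hJ : f.toLinearEquiv (redSection I h.vec) ∈ U.perp J.space := by
    subst hf
    exact (f.map_perp I.space).le (Submodule.mem_map_of_mem h1)
  have h2 := reductionMap_redProj f hf h1
  rw [redProj_redSection] at h2
  -- The `J`-side is evaluated at the representative `f (redSection I h.vec)` instead of the one
  -- picked by the section of `J`.
  have h3 := restrictModel_apply ψ (s.1.1 (liftOLag J (N.map (reductionMap f hf))))
    (h := ⟨f.toLinearEquiv (redSection I h.vec), h.cen⟩) hJ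
  rw [← h2] at h3
  exact h3.trans (section_congr ψ s.1.1 (liftOLag_map f hf N).symm _)

/-- This is naturality for the automorphism `g⁻¹` of the pair of `V` and `I`. -/
theorem reductionEquiv_weilRep (hF : ringChar F ≠ 2) (hψ : ψ ≠ 1) (I : OIso V) (g : stabilizer I) :
    (reductionEquiv ψ hF hψ V I).toLinearMap ∘ₗ weilRepInvariant ψ I g =
      weilRep ψ (reduction V I) (stabilizerHom I g) ∘ₗ
        (reductionEquiv ψ hF hψ V I).toLinearMap := by
  have h : weilRep ψ (reduction V I) (stabilizerHom I g) =
      quant ψ (reductionMap (g⁻¹ : stabilizer I).1 (g⁻¹ : stabilizer I).2) := by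
    change quant ψ (stabilizerHom I g)⁻¹ = _
    rw [← map_inv]
    rfl
  rw [h]
  exact (quant_reductionEquiv ψ hF hψ _ _).symm

end CanonicalReduction
end Quantization

end

theorem mainTheorem9 {F : Type u} [Field F] [Fintype F] [DecidableEq F]
    (hF : ringChar F ≠ 2) (ψ : AddChar F ℂ) (hψ : ψ ≠ 1) :
    (∀ V : Quantization.SympSpace.{u, v} F,
      ∃! T : Quantization.System ψ V, Quantization.IsCanonicalSystem ψ T) ∧
    ∃ α : ∀ (V : Quantization.SympSpace.{u, v} F) (I : Quantization.OIso V),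
        Quantization.invariantSpace ψ I.space ≃ₗ[ℂ]
          Quantization.canonicalSpace ψ (Quantization.reduction V I),
      (∀ (V U : Quantization.SympSpace.{u, v} F) (I : Quantization.OIso V)
          (J : Quantization.OIso U) (f : Quantization.SympIso V U) (hf : I.map f = J),
        Quantization.quant ψ (Quantization.reductionMap f hf) ∘ₗ (α U J).toLinearMap =
          (α V I).toLinearMap ∘ₗ Quantization.quantInvariant ψ f hf) ∧
      (∀ (V : Quantization.SympSpace.{u, v} F) (I : Quantization.OIso V)
          (g : Quantization.stabilizer I),
        (α V I).toLinearMap ∘ₗ Quantization.weilRepInvariant ψ I g =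
          Quantization.weilRep ψ (Quantization.reduction V I) (Quantization.stabilizerHom I g) ∘ₗ
            (α V I).toLinearMap) := by
  refine ⟨fun V => ?_, Quantization.reductionEquiv ψ hF hψ, ?_, ?_⟩
  · obtain ⟨T, hT⟩ := Quantization.exists_isCanonicalSystem ψ hF hψ V
    exact ⟨T, hT, fun T' hT' => hT'.unique ψ hT⟩
  · intro V U I J f hf
    exact Quantization.quant_reductionEquiv ψ hF hψ f hf
  · intro V I g
    exact Quantization.reductionEquiv_weilRep ψ hF hψ I g
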